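/- All rings are commutative with $1$. A diagram of rings $(I,S)$ is a small category $I$ with a functor $S\colon I\to\mathrm{Ring}$. An $(I,S)$-module $M$ consists of an $S(i)$-module $M(i)$ for each object $i$ and an $S(\rho)$-semilinear map $M(\rho)\colon M(i)\to M(j)$ for each $\rho\colon i\to j$, functorial in $\rho$; morphisms are natural families of linear maps. $M$ is coCartesian if for every $\rho\colon i\to j$ the induced map $M(i)\otimes_{S(i)}S(j)\to M(j)$ is an isomorphism, and it is finitely generated if every $M(i)$ is a finitely generated $S(i)$-module. A morphism of diagrams of rings $(\alpha,\mu)\colon(I,S)\to(J,T)$ is a functor $\alpha\colon I\to J$ together with a natural transformation $\mu\colon T\circ\alpha\Rightarrow S$; it induces the pull-back functor $((\alpha,\mu)^*M)(i)=M(\alpha(i))\otimes_{T(\alpha(i))}S(i)$. The morphism $(\alpha,\mu)$ is of descent for finitely generated modules if $(\alpha,\mu)^*$ is an equivalence from the category of finitely generated coCartesian $(J,T)$-modules to the category of finitely generated coCartesian $(I,S)$-modules. Diagrams of $R$-algebras and their morphisms are defined in the same way (with $\mu$ a transformation of $R$-algebras), and the notions above are applied to the underlying diagrams of rings. Proposition.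 Let $R$ be a ring and $\mathfrak a\subseteq R$ an ideal. For an $R$-algebra $A$ let $C_{\mathfrak a}A=\varprojlim_n A/\mathfrak a^nA$ be its $\mathfrak a$-adic completion, and for a diagram $F$ of $R$-algebras let $C_{\mathfrak a}F$ be the diagram obtained by applying the functor $C_{\mathfrak a}$ to $F$. Let $(\alpha,\mu)\colon(I,F)\to(J,G)$ be a morphism of diagrams of noetherian $R$-algebras such that all the $R$-algebras $C_{\mathfrak a}F(i)$ ($i\in I$) and $C_{\mathfrak a}G(j)$ ($j\in J$) are $\mathfrak a$-adically separated and noetherian. If $(\alpha,\mu)$ is of descent for finitely generated modules, then the completed morphism $(\alpha,C_{\mathfrak a}\mu)\colon(I,C_{\mathfrak a}F)\to(J,C_{\mathfrak a}G)$ is of descent for finitely generated modules. -/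

import Mathlib

open CategoryTheory
open scoped TensorProduct

universe v v₁ v₂ u u₁ u₂

/-! ### Base change along a ring homomorphism, and coCartesian semilinear maps -/

section BaseChange

variable {A B A' B' : Type v} [CommRing A] [CommRing B] [CommRing A'] [CommRing B']

/-- The base change `B ⊗[A] M` of an `A`-module `M` along a ring homomorphism `f : A →+* B`. -/
def BaseChange (f : A →+* B) (M : Type v) [AddCommGroup M] [Module A M] : Type v :=
  letI := f.toAlgebra
  B ⊗[A] M

namespace BaseChange

noncomputable instance (f : A →+* B) (M : Type v) [AddCommGroup M] [Module A M] :
    AddCommGroup (BaseChange f M) :=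
  letI := f.toAlgebra
  (TensorProduct.addCommGroup : AddCommGroup (B ⊗[A] M))

/-- `B` acts on `B ⊗[A] M` through the left factor. -/
noncomputable instance (f : A →+* B) (M : Type v) [AddCommGroup M] [Module A M] :
    Module B (BaseChange f M) :=
  letI := f.toAlgebra
  (TensorProduct.leftModule : Module B (B ⊗[A] M))

variable (f : A →+* B) {M N P : Type v} [AddCommGroup M] [Module A M] [AddCommGroup N] [Module A N]
  [AddCommGroup P] [Module B P]

/-- The pure tensor `b ⊗ m`. -/
noncomputable def tmul (b : B) (m : M) : BaseChange f M :=
  letI := f.toAlgebra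
  b ⊗ₜ[A] m

variable {f}

@[elab_as_elim]
theorem induction_on {p : BaseChange f M → Prop} (x : BaseChange f M) (zero : p 0)
    (tmul : ∀ b m, p (tmul f b m)) (add : ∀ x y, p x → p y → p (x + y)) : p x :=
  letI := f.toAlgebra
  TensorProduct.induction_on x zero tmul add

theorem smul_tmul (b b' : B) (m : M) : b • tmul f b' m = tmul f (b * b') m := rfl

/-- Additive maps out of `B ⊗[A] M` from balanced biadditive maps. -/
noncomputable def liftAdd {Q : Type v} [AddCommGroup Q] (h : B →+ M →+ Q)
    (hh : ∀ (a : A) (b : B) (m : M), h (f a * b) m = h b (a • m)) : BaseChange f M →+ Q :=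
  letI := f.toAlgebra
  TensorProduct.liftAddHom h (fun a b m => by rw [Algebra.smul_def]; exact hh a b m)

theorem liftAdd_tmul {Q : Type v} [AddCommGroup Q] (h : B →+ M →+ Q)
    (hh : ∀ (a : A) (b : B) (m : M), h (f a * b) m = h b (a • m)) (b : B) (m : M) :
    liftAdd h hh (tmul f b m) = h b m := rfl

theorem add_tmul (b b' : B) (m : M) : tmul f (b + b') m = tmul f b m + tmul f b' m :=
  letI := f.toAlgebra
  TensorProduct.add_tmul b b' m

theorem tmul_add (b : B) (m m' : M) : tmul f b (m + m') = tmul f b m + tmul f b m' :=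
  letI := f.toAlgebra
  TensorProduct.tmul_add b m m'

theorem tmul_zero (b : B) : tmul f b (0 : M) = 0 :=
  letI := f.toAlgebra
  TensorProduct.tmul_zero M b

theorem mul_tmul (a : A) (b : B) (m : M) : tmul f (f a * b) m = tmul f b (a • m) :=
  letI := f.toAlgebra
  TensorProduct.smul_tmul a b m

/-- The `B`-linear map `B ⊗[A] M → P`, `b ⊗ m ↦ b • φ m`, induced by an `f`-semilinear map
`φ : M → P`. -/
noncomputable def lift (φ : M →ₛₗ[f] P) : BaseChange f M →ₗ[B] P where
  toFun := liftAdd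
    (AddMonoidHom.mk' (fun b => AddMonoidHom.mk' (fun m => b • φ m) (by simp))
      (fun b b' => by ext m; simp [add_smul]))
    (fun a b m => by simp [mul_comm (f a) b, mul_smul])
  map_add' := map_add _
  map_smul' b x := by
    induction x using induction_on with
    | zero => simp
    | tmul b' m => simp [smul_tmul, liftAdd_tmul, mul_smul]
    | add x y hx hy => simp only [smul_add, map_add, hx, hy]

@[simp]
theorem lift_tmul (φ : M →ₛₗ[f] P) (b : B) (m : M) : lift φ (tmul f b m) = b • φ m := rfl

/-- For a commutative square of rings and a `g`-semilinear map `φ : M → M'`, the `g'`-semilinear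
map `B ⊗[A] M → B' ⊗[A'] M'`, `b ⊗ m ↦ g' b ⊗ φ m`. -/
noncomputable def map {f' : A' →+* B'} {g : A →+* A'} {g' : B →+* B'}
    (h : f'.comp g = g'.comp f) {M' : Type v} [AddCommGroup M'] [Module A' M']
    (φ : M →ₛₗ[g] M') : BaseChange f M →ₛₗ[g'] BaseChange f' M' where
  toFun := liftAdd
    (AddMonoidHom.mk' (fun b => AddMonoidHom.mk' (fun m => tmul f' (g' b) (φ m))
        (by simp [tmul_add]))
      (fun b b' => by ext m; simp [add_tmul]))
    (fun a b m => by
      have := congr($h a)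
      simp only [RingHom.comp_apply] at this
      simp [← mul_tmul, this])
  map_add' := map_add _
  map_smul' b x := by
    induction x using induction_on with
    | zero => simp
    | tmul b' m => simp [smul_tmul, liftAdd_tmul]
    | add x y hx hy => simp only [smul_add, map_add, hx, hy]

@[simp]
theorem map_tmul {f' : A' →+* B'} {g : A →+* A'} {g' : B →+* B'}
    (h : f'.comp g = g'.comp f) {M' : Type v} [AddCommGroup M'] [Module A' M']
    (φ : M →ₛₗ[g] M') (b : B) (m : M) : map h φ (tmul f b m) = tmul f' (g' b) (φ m) := rfl

/-- The `B`-linear map `B ⊗[A] M → B ⊗[A] N` induced by an `A`-linear map `M → N`. -/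
noncomputable def mapLinear (f : A →+* B) (φ : M →ₗ[A] N) : BaseChange f M →ₗ[B] BaseChange f N :=
  map (g := RingHom.id A) (g' := RingHom.id B) (by ext; rfl) φ

@[simp]
theorem mapLinear_tmul (φ : M →ₗ[A] N) (b : B) (m : M) :
    mapLinear f φ (tmul f b m) = tmul f b (φ m) := rfl

theorem finite (f : A →+* B) (hM : Module.Finite A M) : Module.Finite B (BaseChange f M) :=
  letI := f.toAlgebra
  (Module.Finite.base_change A B M : Module.Finite B (B ⊗[A] M))

end BaseChange

/-- A semilinear map `φ : M → P` over `f : A →+* B` is coCartesian if the induced `B`-linear map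
`B ⊗[A] M → P` is an isomorphism. -/
def IsCocartesianMap {f : A →+* B} {M P : Type v} [AddCommGroup M] [Module A M]
    [AddCommGroup P] [Module B P] (φ : M →ₛₗ[f] P) : Prop :=
  Function.Bijective (BaseChange.lift φ)

open BaseChange in
/-- Base change along commutative squares of rings preserves coCartesian maps. -/
theorem IsCocartesianMap.baseChange_map {f : A →+* B} {f' : A' →+* B'} {g : A →+* A'}
    {g' : B →+* B'} (h : f'.comp g = g'.comp f) {M M' : Type v} [AddCommGroup M] [Module A M]
    [AddCommGroup M'] [Module A' M'] {φ : M →ₛₗ[g] M'} (hφ : IsCocartesianMap φ) :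
    IsCocartesianMap (BaseChange.map h φ) := by
  have hsq : ∀ a, f' (g a) = g' (f a) := fun a => congr($h a)
  have mul_tmul' : ∀ (a : A) (m : M), tmul f (f a) m = tmul f 1 (a • m) := fun a m => by
    rw [← mul_tmul, mul_one]
  let κ₀ : BaseChange g M →+ BaseChange g' (BaseChange f M) := liftAdd
    (AddMonoidHom.mk' (fun a' => AddMonoidHom.mk'
        (fun m => tmul g' (f' a') (tmul f 1 m)) (by simp [tmul_add]))
      (fun b b' => by ext m; simp [add_tmul]))
    (fun a b m => by
      simp only [AddMonoidHom.mk'_apply, map_mul, hsq]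
      rw [mul_tmul, smul_tmul, mul_one, mul_tmul'])
  have hκ₀_tmul : ∀ a' m, κ₀ (tmul g a' m) = tmul g' (f' a') (tmul f 1 m) := fun _ _ => rfl
  have hκ₀ : ∀ (a' : A') (x : BaseChange g M), κ₀ (a' • x) = f' a' • κ₀ x := by
    intro a' x
    induction x using induction_on with
    | zero => simp
    | tmul b' m => simp only [smul_tmul, hκ₀_tmul, map_mul]
    | add x y hx hy => simp only [smul_add, map_add, hx, hy]
  obtain ⟨e, he⟩ : ∃ e : BaseChange g M ≃ₗ[A'] M', ∀ x, e x = BaseChange.lift φ x :=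
    ⟨LinearEquiv.ofBijective (BaseChange.lift φ) hφ, fun _ => rfl⟩
  let κ : M' →ₛₗ[f'] BaseChange g' (BaseChange f M) :=
    { toFun := fun m' => κ₀ (e.symm m')
      map_add' := by simp
      map_smul' := fun a' m' => by rw [map_smul, hκ₀] }
  have hκ' : ∀ m', κ m' = κ₀ (e.symm m') := fun _ => rfl
  have hκ : ∀ m, κ (φ m) = tmul g' 1 (tmul f 1 m) := by
    intro m
    have : e.symm (φ m) = tmul g 1 m := by
      rw [LinearEquiv.symm_apply_eq, he, lift_tmul, one_smul]
    rw [hκ', this, hκ₀_tmul, map_one]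
  have h1 : ∀ x, BaseChange.lift κ (BaseChange.lift (BaseChange.map h φ) x) = x := by
    intro x
    induction x using induction_on with
    | zero => simp
    | add x y hx hy => simp only [map_add, hx, hy]
    | tmul b' y =>
      induction y using induction_on with
      | zero => simp [BaseChange.tmul_zero]
      | add x y hx hy => simp only [tmul_add, map_add, hx, hy]
      | tmul b m =>
        rw [lift_tmul, BaseChange.map_tmul, smul_tmul, lift_tmul, hκ, smul_tmul, mul_one,
          mul_comm, mul_tmul, smul_tmul, mul_one]
  have key : ∀ y : BaseChange g M, BaseChange.lift (BaseChange.map h φ) (κ₀ y)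
      = tmul f' 1 (e y) := by
    intro y
    induction y using induction_on with
    | zero => simp [BaseChange.tmul_zero]
    | add x y hx hy => simp only [tmul_add, map_add, hx, hy]
    | tmul a' m =>
      rw [hκ₀_tmul, lift_tmul, BaseChange.map_tmul, map_one, smul_tmul, he, lift_tmul, mul_tmul]
  have h2 : ∀ x, BaseChange.lift (BaseChange.map h φ) (BaseChange.lift κ x) = x := by
    intro x
    induction x using induction_on with
    | zero => simp
    | add x y hx hy => simp only [map_add, hx, hy]
    | tmul b' m' =>
      rw [lift_tmul, map_smul, hκ', key, LinearEquiv.apply_symm_apply, smul_tmul, mul_one]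
  exact Function.bijective_iff_has_inverse.2 ⟨_, h1, h2⟩

end BaseChange

/-! ### Modules over diagrams of commutative rings -/

section Diagrams

variable {I : Type u₁} [Category.{v₁} I] {J : Type u₂} [Category.{v₂} J]

/-- An `(I, S)`-module, for a diagram `S : I ⥤ CommRingCat` of commutative rings: a functor from `I`
to the category of pairs (ring, module) lifting `S`. Explicitly, an `S i`-module `M i` for every
object `i`, and functorial `S ρ`-semilinear maps `M i → M j` for all `ρ : i ⟶ j`. -/
structure DiagMod (S : I ⥤ CommRingCat.{v}) where
  obj (i : I) : ModuleCat.{v} (S.obj i)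
  map {i j : I} (ρ : i ⟶ j) : obj i →ₛₗ[(S.map ρ).hom] obj j
  map_id (i : I) (x : obj i) : map (𝟙 i) x = x
  map_comp {i j k : I} (ρ : i ⟶ j) (σ : j ⟶ k) (x : obj i) : map (ρ ≫ σ) x = map σ (map ρ x)

namespace DiagMod

variable {S : I ⥤ CommRingCat.{v}} {T : J ⥤ CommRingCat.{v}}

/-- A morphism of `(I, S)`-modules: a natural family of linear maps. -/
@[ext]
structure Hom (M N : DiagMod S) where
  app (i : I) : M.obj i →ₗ[S.obj i] N.obj i
  naturality {i j : I} (ρ : i ⟶ j) (x : M.obj i) : app j (M.map ρ x) = N.map ρ (app i x)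

instance : Category (DiagMod S) where
  Hom := Hom
  id M := { app := fun _ => LinearMap.id, naturality := fun _ _ => rfl }
  comp φ ψ :=
    { app := fun i => (ψ.app i).comp (φ.app i)
      naturality := fun ρ x => by simp [φ.naturality, ψ.naturality] }

@[ext]
theorem hom_ext {M N : DiagMod S} {φ ψ : M ⟶ N} (h : ∀ i, Hom.app φ i = Hom.app ψ i) : φ = ψ :=
  Hom.ext (funext h)

/-- An `(I, S)`-module is coCartesian if all its transition maps are. -/
def IsCocartesian (M : DiagMod S) : Prop :=
  ∀ ⦃i j : I⦄ (ρ : i ⟶ j), IsCocartesianMap (M.map ρ)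

/-- An `(I, S)`-module is finite if all its values are finitely generated modules. -/
def IsFinite (M : DiagMod S) : Prop :=
  ∀ i, Module.Finite (S.obj i) (M.obj i)

variable (S) in
/-- The property of being finite and coCartesian; `(finiteCocartesian S).FullSubcategory` is the
full subcategory of finite coCartesian `(I, S)`-modules. -/
def finiteCocartesian : ObjectProperty (DiagMod S) := fun M => M.IsFinite ∧ M.IsCocartesian

theorem square {α : I ⥤ J} (μ : α ⋙ T ⟶ S) {i i' : I} (ρ : i ⟶ i') :
    (μ.app i').hom.comp (T.map (α.map ρ)).hom = (S.map ρ).hom.comp (μ.app i).hom := by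
  have := μ.naturality ρ
  exact congrArg CommRingCat.Hom.hom this

/-- The pull-back along a morphism of diagrams `(α, μ) : (I, S) ⟶ (J, T)`, given by a functor
`α : I ⥤ J` and a natural transformation `μ : T ∘ α ⟶ S`:
`((α, μ)^* M) i = S i ⊗[T (α i)] M (α i)`. -/
noncomputable def pullback (α : I ⥤ J) (μ : α ⋙ T ⟶ S) : DiagMod T ⥤ DiagMod S where
  obj M :=
    { obj := fun i => ModuleCat.of (S.obj i) (BaseChange (μ.app i).hom (M.obj (α.obj i)))
      map := fun ρ => BaseChange.map (square μ ρ) (M.map (α.map ρ))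
      map_id := fun i x => by
        induction x using BaseChange.induction_on with
        | zero => exact map_zero _
        | tmul b m =>
          rw [BaseChange.map_tmul]
          congr 1
          · simp
          · rw [α.map_id]; exact M.map_id _ _
        | add x y hx hy => rw [map_add, hx, hy]
      map_comp := fun ρ σ x => by
        induction x using BaseChange.induction_on with
        | zero => simp only [map_zero]
        | tmul b m =>
          simp only [BaseChange.map_tmul]
          congr 1
          · simp
          · rw [α.map_comp]; exact M.map_comp _ _ _
        | add x y hx hy => simp only [map_add, hx, hy] }
  map φ :=
    { app := fun i => BaseChange.mapLinear (μ.app i).hom (Hom.app φ (α.obj i))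
      naturality := fun ρ x => by
        induction x using BaseChange.induction_on with
        | zero => simp only [map_zero]
        | tmul b m =>
          simp only [BaseChange.map_tmul, BaseChange.mapLinear_tmul]
          congr 1
          exact Hom.naturality φ _ _
        | add x y hx hy => simp only [map_add, hx, hy] }
  map_id M := by
    apply hom_ext
    intro i
    ext x
    induction x using BaseChange.induction_on with
    | zero => exact map_zero _
    | tmul b m => rfl
    | add x y hx hy => exact (map_add _ _ _).trans (congr_arg₂ (· + ·) hx hy)
  map_comp φ ψ := by
    apply hom_ext
    intro i
    ext x
    induction x using BaseChange.induction_on with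
    | zero => exact (map_zero _).trans (map_zero _).symm
    | tmul b m => rfl
    | add x y hx hy =>
      exact (map_add _ _ _).trans ((congr_arg₂ (· + ·) hx hy).trans (map_add _ _ _).symm)

theorem finiteCocartesian_pullback (α : I ⥤ J) (μ : α ⋙ T ⟶ S) (M : DiagMod T)
    (hM : finiteCocartesian T M) : finiteCocartesian S ((pullback α μ).obj M) :=
  ⟨fun i => BaseChange.finite (μ.app i).hom (hM.1 (α.obj i)),
    fun _ _ ρ => (hM.2 (α.map ρ)).baseChange_map (square μ ρ)⟩

/-- The pull-back functor between the categories of finite coCartesian modules. -/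
noncomputable def pullbackFiniteCocartesian (α : I ⥤ J) (μ : α ⋙ T ⟶ S) :
    (finiteCocartesian T).FullSubcategory ⥤ (finiteCocartesian S).FullSubcategory :=
  (finiteCocartesian S).lift ((finiteCocartesian T).ι ⋙ pullback α μ)
    (fun M => finiteCocartesian_pullback α μ M.obj M.property)

end DiagMod

/-- A morphism `(α, μ) : (I, S) ⟶ (J, T)` of diagrams of commutative rings is of descent for
finitely generated modules if pull-back is an equivalence between the categories of finite
coCartesian modules. -/
def IsOfFiniteDescent {S : I ⥤ CommRingCat.{v}} {T : J ⥤ CommRingCat.{v}}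
    (α : I ⥤ J) (μ : α ⋙ T ⟶ S) : Prop :=
  (DiagMod.pullbackFiniteCocartesian α μ).IsEquivalence

variable {R : Type u} [CommRing R]

/-- A morphism `(α, μ) : (I, F) ⟶ (J, G)` of diagrams of commutative `R`-algebras is of descent for
finitely generated modules if the underlying morphism of diagrams of rings is. -/
def IsOfFiniteDescentAlg {F : I ⥤ CommAlgCat.{v} R} {G : J ⥤ CommAlgCat.{v} R}
    (α : I ⥤ J) (μ : α ⋙ G ⟶ F) : Prop :=
  IsOfFiniteDescent (S := F ⋙ forget₂ (CommAlgCat.{v} R) CommRingCat.{v})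
    (T := G ⋙ forget₂ (CommAlgCat.{v} R) CommRingCat.{v}) α
    (Functor.whiskerRight μ (forget₂ (CommAlgCat.{v} R) CommRingCat.{v}))

end Diagrams

/-! ### The `𝔞`-adic completion functor on `R`-algebras -/

section Completion

variable {R : Type u} [CommRing R] (𝔞 : Ideal R)

/-- The extension `𝔞 A` of `𝔞` to an `R`-algebra `A`. -/
abbrev extIdeal (A : Type v) [CommRing A] [Algebra R A] : Ideal A := 𝔞.map (algebraMap R A)

theorem extIdeal_pow_le_comap {A B : Type v} [CommRing A] [CommRing B] [Algebra R A] [Algebra R B]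
    (f : A →ₐ[R] B) (n : ℕ) :
    extIdeal 𝔞 A ^ n ≤ (extIdeal 𝔞 B ^ n).comap f := by
  refine le_trans (Ideal.pow_right_mono ?_ n) (Ideal.le_comap_pow f n)
  rw [Ideal.map_le_iff_le_comap]
  intro r hr
  simpa using Ideal.mem_map_of_mem (algebraMap R B) hr

theorem completionMap_compat {A B : Type v} [CommRing A] [CommRing B] [Algebra R A] [Algebra R B]
    (f : A →ₐ[R] B) {m n : ℕ} (hle : m ≤ n) :
    (Ideal.Quotient.factorₐ R (Ideal.pow_le_pow_right hle)).comp
      ((Ideal.quotientMapₐ (extIdeal 𝔞 B ^ n) f (extIdeal_pow_le_comap 𝔞 f n)).comp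
        ((AdicCompletion.evalₐ (extIdeal 𝔞 A) n).restrictScalars R)) =
      (Ideal.quotientMapₐ (extIdeal 𝔞 B ^ m) f (extIdeal_pow_le_comap 𝔞 f m)).comp
        ((AdicCompletion.evalₐ (extIdeal 𝔞 A) m).restrictScalars R) := by
  ext x
  simp only [AlgHom.comp_apply, AlgHom.restrictScalars_apply]
  obtain ⟨y, rfl⟩ := AdicCompletion.mk_surjective _ _ x
  rw [AdicCompletion.evalₐ_mk, AdicCompletion.evalₐ_mk,
    ← AdicCompletion.Ideal.mk_eq_mk (extIdeal 𝔞 A) hle y]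
  rfl

/-- The map `C_𝔞 A → C_𝔞 B` between the `𝔞`-adic completions `C_𝔞 A = lim A / 𝔞 ^ n A` and
`C_𝔞 B = lim B / 𝔞 ^ n B` induced by `f : A →ₐ[R] B`. -/
noncomputable def completionMap {A B : Type v} [CommRing A] [CommRing B] [Algebra R A] [Algebra R B]
    (f : A →ₐ[R] B) :
    AdicCompletion (extIdeal 𝔞 A) A →ₐ[R] AdicCompletion (extIdeal 𝔞 B) B :=
  AdicCompletion.liftAlgHom (extIdeal 𝔞 B)
    (fun n => (Ideal.quotientMapₐ (extIdeal 𝔞 B ^ n) f (extIdeal_pow_le_comap 𝔞 f n)).comp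
      ((AdicCompletion.evalₐ (extIdeal 𝔞 A) n).restrictScalars R))
    (completionMap_compat 𝔞 f)

theorem evalₐ_completionMap {A B : Type v} [CommRing A] [CommRing B] [Algebra R A] [Algebra R B]
    (f : A →ₐ[R] B) (n : ℕ) (x : AdicCompletion (extIdeal 𝔞 A) A) :
    AdicCompletion.evalₐ (extIdeal 𝔞 B) n (completionMap 𝔞 f x) =
      Ideal.quotientMapₐ (extIdeal 𝔞 B ^ n) f (extIdeal_pow_le_comap 𝔞 f n)
        (AdicCompletion.evalₐ (extIdeal 𝔞 A) n x) :=
  AdicCompletion.evalₐ_liftAlgHom (extIdeal 𝔞 B) _ (completionMap_compat 𝔞 f) n x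

theorem completionMap_id (A : Type v) [CommRing A] [Algebra R A] :
    completionMap 𝔞 (AlgHom.id R A) = AlgHom.id R _ := by
  refine AlgHom.ext fun x => AdicCompletion.ext_evalₐ fun n => ?_
  rw [evalₐ_completionMap, AlgHom.id_apply]
  obtain ⟨y, hy⟩ := Ideal.Quotient.mk_surjective (AdicCompletion.evalₐ (extIdeal 𝔞 A) n x)
  rw [← hy]
  rfl

theorem completionMap_comp {A B C : Type v} [CommRing A] [CommRing B] [CommRing C] [Algebra R A]
    [Algebra R B] [Algebra R C] (f : A →ₐ[R] B) (g : B →ₐ[R] C) :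
    completionMap 𝔞 (g.comp f) = (completionMap 𝔞 g).comp (completionMap 𝔞 f) := by
  refine AlgHom.ext fun x => AdicCompletion.ext_evalₐ fun n => ?_
  rw [AlgHom.comp_apply, evalₐ_completionMap, evalₐ_completionMap, evalₐ_completionMap]
  obtain ⟨y, hy⟩ := Ideal.Quotient.mk_surjective (AdicCompletion.evalₐ (extIdeal 𝔞 A) n x)
  rw [← hy]
  rfl

/-- The `𝔞`-adic completion functor `C_𝔞`, `A ↦ lim A / 𝔞 ^ n A`, on commutative `R`-algebras. -/
noncomputable def completionFunctor : CommAlgCat.{v} R ⥤ CommAlgCat.{v} R where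
  obj A := CommAlgCat.of R (AdicCompletion (extIdeal 𝔞 A) A)
  map f := CommAlgCat.ofHom (completionMap 𝔞 f.hom)
  map_id A := CommAlgCat.hom_ext (completionMap_id 𝔞 A)
  map_comp f g := CommAlgCat.hom_ext (completionMap_comp 𝔞 f.hom g.hom)

end Completion

/-! ### Complete modules over adically complete rings -/

section Complete

variable {R : Type u} [CommRing R] {I : Ideal R} {M : Type v} [AddCommGroup M] [Module R M]

/-! Completion changes nothing modulo powers of `𝔞`. Each algebra `A` of the given diagrams is
noetherian, so `𝔞A` is finitely generated; hence `C_𝔞 A` is complete, the kernel of `C_𝔞 A → A / 𝔞 ^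
n A` is `𝔞 ^ n C_𝔞 A`, and both rings have the same quotients modulo `𝔞 ^ n`
(`isNoetherianCompletion_adicCompletion`).

A finite module `M` over the noetherian complete ring `C_𝔞 A` is the limit of its reductions `M / 𝔞
^ n M`, which are finite `A`-modules. Conversely, take `A`-modules `X n` killed by `𝔞 ^ n`, with `X
1` finite and surjections `X (n + 1) → X n` whose kernel lies in `𝔞 ^ n X (n + 1)`. Their limit is a
finite `C_𝔞 A`-module with reductions `X n` (`IsNoetherianCompletion.exists_limit`, by successive
approximation in `finite_and_eq_smul_top_of_filtration`). CoCartesian maps correspond as well: they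
pass to reductions (`IsReduction.isCocartesianMap`), and they are detected there by Nakayama's lemma
and Krull's intersection theorem (`IsNoetherianCompletion.isCocartesianMap`).

So a finite coCartesian module over a completed diagram amounts to a tower of finite coCartesian
modules over the original diagram, and descent can be applied at each level. Uniqueness of descended
morphisms makes the levels compatible, which gives full faithfulness (`existsUnique_of_completion`).
Pull-back commutes with reduction modulo `𝔞 ^ n`, so the descended modules again form a tower, whose
limit gives essential surjectivity (`exists_cocartesianOver_of_completion`). Flatness of `A → C_𝔞 A`
plays no role. -/

theorem Submodule.mem_smul_top_iff_exists_fin {k : ℕ} {g : Fin k → M}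
    (hg : Submodule.span R (Set.range g) = ⊤) {K : Ideal R} {m : M} :
    m ∈ (K • ⊤ : Submodule R M) ↔ ∃ a : Fin k → R, (∀ i, a i ∈ K) ∧ ∑ i, a i • g i = m := by
  rw [← hg, Submodule.mem_ideal_smul_span_iff_exists_sum]
  constructor
  · rintro ⟨a, ha, rfl⟩
    exact ⟨a, ha, (Finsupp.sum_fintype a (fun i c => c • g i) fun _ => zero_smul _ _).symm⟩
  · rintro ⟨a, ha, rfl⟩
    exact ⟨Finsupp.equivFunOnFinite.symm a, ha, Finsupp.sum_fintype _ _ (fun _ => zero_smul _ _)⟩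

theorem isPrecomplete_of_succ
    (h : ∀ f : ℕ → M, (∀ n, f (n + 1) - f n ∈ (I ^ n • ⊤ : Submodule R M)) →
      ∃ L : M, ∀ n, f n - L ∈ (I ^ n • ⊤ : Submodule R M)) : IsPrecomplete I M where
  prec' f hf := by
    obtain ⟨L, hL⟩ := h f fun n => SModEq.sub_mem.1 (hf n.le_succ).symm
    exact ⟨L, fun n => SModEq.sub_mem.2 (hL n)⟩

theorem IsPrecomplete.exists_limit (h : IsPrecomplete I M) {f : ℕ → M}
    (hf : ∀ n, f (n + 1) - f n ∈ (I ^ n • ⊤ : Submodule R M)) :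
    ∃ L : M, ∀ n, f n - L ∈ (I ^ n • ⊤ : Submodule R M) := by
  obtain ⟨L, hL⟩ := h.prec (f := f) fun {m n} hmn => by
    induction n, hmn using Nat.le_induction with
    | base => exact SModEq.rfl
    | succ n hmn ih =>
      exact ih.trans (SModEq.sub_mem.2 (Submodule.pow_smul_top_le I M hmn (hf n))).symm
  exact ⟨L, fun n => SModEq.sub_mem.1 (hL n)⟩

/-- Increments in `I ^ n M` are combinations of the generators with coefficients in `I ^ n`. The
partial sums of these coefficients converge in `R`, and their limits are the coefficients of a limit
in `M`. -/
theorem IsPrecomplete.of_finite (h : IsPrecomplete I R) (hM : Module.Finite R M) :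
    IsPrecomplete I M := by
  obtain ⟨k, g, hg⟩ := Module.Finite.exists_fin (R := R) (M := M)
  refine isPrecomplete_of_succ fun f hf => ?_
  choose d hd hdf using fun n => (Submodule.mem_smul_top_iff_exists_fin hg).1 (hf n)
  obtain ⟨e, -, he⟩ := (Submodule.mem_smul_top_iff_exists_fin (K := ⊤) (m := f 0) hg).1
    (by simp)
  let c : ℕ → Fin k → R := fun n i => e i + ∑ m ∈ Finset.range n, d m i
  have hc : ∀ n, ∑ i, c n i • g i = f n := by
    intro n
    induction n with
    | zero => simpa [c] using he
    | succ n ih =>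
      have : ∀ i, c (n + 1) i = c n i + d n i := fun i => by
        simp [c, Finset.sum_range_succ, add_assoc]
      simp only [this, add_smul, Finset.sum_add_distrib, ih, hdf]
      abel
  have hlim : ∀ i, ∃ l : R, ∀ n, c n i - l ∈ (I ^ n • ⊤ : Submodule R R) := fun i =>
    h.exists_limit fun n => by
      simpa [c, Finset.sum_range_succ] using hd n i
  choose l hl using hlim
  refine ⟨∑ i, l i • g i, fun n => ?_⟩
  refine (Submodule.mem_smul_top_iff_exists_fin hg).2
    ⟨fun i => c n i - l i, fun i => by simpa using hl i n, ?_⟩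
  simp [sub_smul, hc]

/-- A module with a separated exhaustive filtration that is, up to the next step, the adic one. -/
theorem finite_and_eq_smul_top_of_filtration (h : IsPrecomplete I R) (F : ℕ → Submodule R M)
    (hanti : ∀ n, F (n + 1) ≤ F n) (hle : ∀ n, I ^ n • ⊤ ≤ F n)
    (hstep : ∀ n, F n ≤ I ^ n • ⊤ ⊔ F (n + 1)) (hsep : ∀ x, (∀ n, x ∈ F n) → x = 0)
    (hzero : F 0 = ⊤) (N : Submodule R M) (hN : N.FG) (hN1 : N ⊔ F 1 = ⊤) :
    Module.Finite R M ∧ ∀ n, F n = I ^ n • ⊤ := by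
  have hstep' : ∀ n m, n ≤ m → F n ≤ I ^ n • ⊤ ⊔ F m := by
    intro n m hnm
    induction m, hnm using Nat.le_induction with
    | base => exact le_sup_right
    | succ m hnm ih =>
      refine ih.trans (sup_le le_sup_left ((hstep m).trans (sup_le_sup_right ?_ _)))
      exact Submodule.pow_smul_top_le I M hnm
  -- For `n > 0`, `I ^ n M = I ^ n N + I ^ n F 1`, and `F 1 ≤ I M + F (n + 1)` puts the second term
  -- in `I ^ (n + 1) M + F (n + 1) = F (n + 1)`. Thus finitely many generators suffice for
  -- correction at every level.
  have hN2 : ∀ n, F n ≤ I ^ n • N ⊔ F (n + 1) := by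
    intro n
    rcases n.eq_zero_or_pos with rfl | hn
    · simp [hN1]
    refine (hstep n).trans (sup_le ?_ le_sup_right)
    rw [← hN1, Submodule.smul_sup]
    refine sup_le le_sup_left ?_
    refine (Submodule.smul_mono le_rfl (hstep' 1 (n + 1) (by omega))).trans ?_
    rw [Submodule.smul_sup, ← Submodule.mul_smul, ← pow_add]
    exact sup_le ((hle _).trans le_sup_right) (Submodule.smul_le_right.trans le_sup_right)
  obtain ⟨k, g, hg⟩ := Submodule.fg_iff_exists_fin_generating_family.1 hN
  let f : (Fin k → R) →ₗ[R] M := Fintype.linearCombination R g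
  have hf : LinearMap.range f = N := by rw [← hg, Fintype.range_linearCombination]
  -- Successive approximation: the error in `F (n + t)` is corrected by coefficients in `I ^ (n +
  -- t)`. The corrections converge in the free module, and separatedness of `F` makes the limit an
  -- exact preimage.
  have key : ∀ n, ∀ x ∈ F n, ∃ z ∈ (I ^ n • ⊤ : Submodule R (Fin k → R)), f z = x := by
    intro n x hx
    have hnext : ∀ (t : ℕ) (z : Fin k → R), x - f z ∈ F (n + t) → ∃ z' : Fin k → R,
        z' - z ∈ (I ^ (n + t) • ⊤ : Submodule R (Fin k → R)) ∧ x - f z' ∈ F (n + (t + 1)) := by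
      intro t z hz
      obtain ⟨y, hy, w, hw, hyw⟩ := Submodule.mem_sup.1 (hN2 _ hz)
      rw [← hf, LinearMap.range_eq_map, ← Submodule.map_smul''] at hy
      obtain ⟨d, hd, rfl⟩ := hy
      refine ⟨z + d, by simpa using hd, ?_⟩
      have : x - f (z + d) = w := by rw [map_add, ← sub_sub, ← hyw]; abel
      rw [this]
      exact hw
    choose nx hnx1 hnx2 using hnext
    let z : ∀ t, { z : Fin k → R // x - f z ∈ F (n + t) } := fun t =>
      Nat.rec ⟨0, by simpa using hx⟩ (fun t z => ⟨nx t z.1 z.2, hnx2 t z.1 z.2⟩) t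
    have hz : ∀ t, (z (t + 1)).1 - (z t).1 ∈ (I ^ (n + t) • ⊤ : Submodule R (Fin k → R)) :=
      fun t => hnx1 t _ (z t).2
    have hz0 : ∀ t, (z t).1 ∈ (I ^ n • ⊤ : Submodule R (Fin k → R)) := by
      intro t
      induction t with
      | zero => exact zero_mem _
      | succ t ih =>
        have := add_mem (Submodule.pow_smul_top_le I _ (Nat.le_add_right n t) (hz t)) ih
        simpa using this
    have hprec : IsPrecomplete I (Fin k → R) := h.of_finite inferInstance
    obtain ⟨l, hl⟩ := hprec.exists_limit (f := fun t => (z t).1) fun t =>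
      Submodule.pow_smul_top_le I _ (Nat.le_add_left t n) (hz t)
    refine ⟨l, ?_, ?_⟩
    · simpa using sub_mem (hz0 n) (hl n)
    · refine (sub_eq_zero.1 (hsep _ fun t => ?_)).symm
      have h1 : x - f (z t).1 ∈ F t := by
        have hmono : Antitone F := antitone_nat_of_succ_le hanti
        exact hmono (Nat.le_add_left t n) (z t).2
      have h2 : f ((z t).1 - l) ∈ F t := by
        refine hle t ?_
        have := Submodule.mem_map_of_mem (f := f) (hl t)
        rw [Submodule.map_smul''] at this
        exact Submodule.smul_mono le_rfl le_top this
      simpa using add_mem h1 h2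
  constructor
  · have : Function.Surjective f := fun x => by
      obtain ⟨z, -, hz⟩ := key 0 x (by simp [hzero])
      exact ⟨z, hz⟩
    exact Module.Finite.of_surjective f this
  · refine fun n => le_antisymm (fun x hx => ?_) (hle n)
    obtain ⟨z, hz, rfl⟩ := key n x hx
    have := Submodule.mem_map_of_mem (f := f) hz
    rw [Submodule.map_smul''] at this
    exact Submodule.smul_mono le_rfl le_top this

end Complete

/-! ### Reductions of modules modulo an ideal -/

section Reduction

variable {A A' B B' : Type v} [CommRing A] [CommRing A'] [CommRing B] [CommRing B']

/-- `q : M → N` identifies the `A`-module `N` with the quotient `M / K M` of an `A'`-module `M`,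
viewed as an `A`-module by restriction along `e : A →+* A'`. -/
structure IsReduction (e : A →+* A') (K : Ideal A') {M N : Type v} [AddCommGroup M] [Module A' M]
    [AddCommGroup N] [Module A N] (q : M →+ N) : Prop where
  map_smul (a : A) (m : M) : q (e a • m) = a • q m
  surjective : Function.Surjective q
  eq_zero_iff (m : M) : q m = 0 ↔ m ∈ (K • ⊤ : Submodule A' M)

namespace IsReduction

variable {e : A →+* A'} {e' : B →+* B'} {f : A →+* B} {f' : A' →+* B'} {K : Ideal A'}
  {K' : Ideal B'} {M M₀ P P₀ : Type v} [AddCommGroup M] [Module A' M] [AddCommGroup M₀] [Module A M₀]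
  [AddCommGroup P] [Module B' P] [AddCommGroup P₀] [Module B P₀] {q : M →+ M₀} {q' : P →+ P₀}

theorem smul_eq_zero (hq : IsReduction e K q) {a : A'} (ha : a ∈ K) (m : M) : q (a • m) = 0 :=
  (hq.eq_zero_iff _).2 (Submodule.smul_mem_smul ha trivial)

/-- On the reduction, a scalar of `A'` acts through any approximation of it in `A`. With density of
`e` modulo `K`, this replaces `A'`-linearity by `A`-linearity throughout. -/
theorem smul_eq_of_sub_mem (hq : IsReduction e K q) {a : A} {a' : A'} (h : e a - a' ∈ K) (m : M) :
    q (a' • m) = a • q m := by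
  have := hq.smul_eq_zero h m
  rw [sub_smul, map_sub, hq.map_smul, sub_eq_zero] at this
  exact this.symm

theorem eq_iff (hq : IsReduction e K q) (m m' : M) :
    q m = q m' ↔ m - m' ∈ (K • ⊤ : Submodule A' M) := by
  rw [← hq.eq_zero_iff, map_sub, sub_eq_zero]

theorem finite (hq : IsReduction e K q) (hd : ∀ a', ∃ a, e a - a' ∈ K) (hM : Module.Finite A' M) :
    Module.Finite A M₀ := by
  obtain ⟨k, g, hg⟩ := Module.Finite.exists_fin (R := A') (M := M)
  refine Module.Finite.of_surjective (Fintype.linearCombination A fun i => q (g i)) fun x => ?_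
  obtain ⟨m, rfl⟩ := hq.surjective x
  have : m ∈ Submodule.span A' (Set.range g) := hg ▸ trivial
  obtain ⟨c, rfl⟩ := (Submodule.mem_span_range_iff_exists_fun _).1 this
  choose s hs using hd
  refine ⟨fun i => s (c i), ?_⟩
  simp only [Fintype.linearCombination_apply, map_sum]
  exact Finset.sum_congr rfl fun i _ => (hq.smul_eq_of_sub_mem (hs _) _).symm

/-- An additive map killing the kernel of a reduction descends. -/
theorem exists_descend {Q : Type v} [AddCommGroup Q] [Module B Q] (hq : IsReduction e K q)
    (φ : M →+ Q) (hφ : ∀ (a : A) (m : M), φ (e a • m) = f a • φ m)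
    (h0 : ∀ a ∈ K, ∀ m, φ (a • m) = 0) : ∃ ψ : M₀ →ₛₗ[f] Q, ∀ m, ψ (q m) = φ m := by
  have hker : ∀ m, q m = 0 → φ m = 0 := fun m hm => by
    have := (hq.eq_zero_iff m).1 hm
    induction this using Submodule.smul_induction_on' with
    | smul a ha m _ => exact h0 a ha m
    | add x hx y hy h1 h2 =>
      rw [map_add, h1 ((hq.eq_zero_iff x).2 hx), h2 ((hq.eq_zero_iff y).2 hy), add_zero]
  have hwd : ∀ m m', q m = q m' → φ m = φ m' := fun m m' h => by
    rw [← sub_eq_zero, ← map_sub]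
    exact hker _ (by rw [map_sub, h, sub_self])
  have hs := Function.surjInv_eq hq.surjective
  refine ⟨{ toFun := fun x => φ (Function.surjInv hq.surjective x), map_add' := fun x y => ?_,
            map_smul' := fun a x => ?_ }, fun m => hwd _ _ (hs _)⟩
  · rw [← map_add]
    exact hwd _ _ (by rw [map_add, hs, hs, hs])
  · rw [← hφ]
    exact hwd _ _ (by rw [hq.map_smul, hs, hs])

theorem exists_map (hq : IsReduction e K q) (hq' : IsReduction e' K' q')
    (hsq : f'.comp e = e'.comp f) (hK : ∀ a ∈ K, f' a ∈ K') (φ : M →ₛₗ[f'] P) :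
    ∃ ψ : M₀ →ₛₗ[f] P₀, ∀ m, ψ (q m) = q' (φ m) :=
  hq.exists_descend (q'.comp φ.toAddMonoidHom)
    (fun a m => by
      have : f' (e a) = e' (f a) := congr($hsq a)
      simp [this, hq'.map_smul])
    (fun a ha m => by simpa using hq'.smul_eq_zero (hK a ha) _)

variable (e K M) in
theorem exists_of_ideal : ∃ (Q : ModuleCat.{v} A) (q : M →+ Q), IsReduction e K q := by
  let _ := Module.compHom (M ⧸ (K • ⊤ : Submodule A' M)) e
  exact ⟨ModuleCat.of A (M ⧸ (K • ⊤ : Submodule A' M)),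
    (Submodule.mkQ (K • ⊤ : Submodule A' M)).toAddMonoidHom,
    fun _ _ => rfl, Submodule.mkQ_surjective _, fun m => Submodule.Quotient.mk_eq_zero _⟩

open BaseChange in
/-- The reduction of a coCartesian map is coCartesian. -/
theorem isCocartesianMap (hq : IsReduction e K q) (hq' : IsReduction e' K' q')
    (hsq : f'.comp e = e'.comp f)
    (hK : ∀ a ∈ K, f' a ∈ K') (hA : ∀ a', ∃ a, e a - a' ∈ K) (hB : ∀ b', ∃ b, e' b - b' ∈ K')
    (hker : K'.comap e' ≤ (K.comap e).map f) {φ : M →ₛₗ[f'] P} {φ₀ : M₀ →ₛₗ[f] P₀}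
    (hφ₀ : ∀ m, φ₀ (q m) = q' (φ m)) (hφ : IsCocartesianMap φ) : IsCocartesianMap φ₀ := by
  have hsq' : ∀ a, f' (e a) = e' (f a) := fun a => congr($hsq a)
  -- `K.comap e` kills `M₀`, hence its extension to `B` kills the base change; `hker` says that this
  -- extension contains `K'.comap e'`.
  have hkill : ∀ b ∈ K'.comap e', ∀ z : BaseChange f M₀, b • z = 0 := by
    intro b hb z
    refine Submodule.span_induction (p := fun b _ => b • z = 0) ?_ (zero_smul _ _)
      (fun x y _ _ hx hy => by rw [add_smul, hx, hy, add_zero])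
      (fun c x _ hx => by rw [smul_assoc, hx, smul_zero]) (hker hb)
    rintro _ ⟨a, ha, rfl⟩
    induction z using BaseChange.induction_on with
    | zero => exact smul_zero _
    | add x y hx hy => rw [smul_add, hx, hy, add_zero]
    | tmul b m =>
      obtain ⟨m, rfl⟩ := hq.surjective m
      rw [smul_tmul, mul_tmul, ← hq.map_smul, hq.smul_eq_zero ha, BaseChange.tmul_zero]
  -- The section `s` is additive and multiplicative only modulo `K'.comap e'`, which acts as zero.
  -- So `b ⊗ m ↦ s b • (1 ⊗ q m)` is a well-defined map `κ₀` from the base change of `M` to that of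
  -- `M₀`, and it kills multiples of `K'`.
  choose s hs using hB
  have hs_add : ∀ b b' (z : BaseChange f M₀), s (b + b') • z = s b • z + s b' • z := by
    intro b b' z
    rw [← add_smul, ← sub_eq_zero, ← sub_smul]
    refine hkill _ ?_ z
    have := sub_mem (sub_mem (hs (b + b')) (hs b)) (hs b')
    rw [Ideal.mem_comap, map_sub, map_add]
    convert this using 1
    ring
  have hs_mul : ∀ b b' c (z : BaseChange f M₀), e' c - b ∈ K' → s (b * b') • z = c • s b' • z := by
    intro b b' c z hc
    rw [← mul_smul, ← sub_eq_zero, ← sub_smul]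
    refine hkill _ ?_ z
    have := sub_mem (sub_mem (hs (b * b')) (Ideal.mul_mem_right b' _ hc))
      (Ideal.mul_mem_left _ (e' c) (hs b'))
    rw [Ideal.mem_comap, map_sub, map_mul]
    convert this using 1
    ring
  have hbal : ∀ a b m, s (f' a * b) • tmul f 1 (q m) = s b • tmul f 1 (q (a • m)) := by
    intro a b m
    obtain ⟨a₀, ha₀⟩ := hA a
    rw [hs_mul (f' a) b (f a₀) _ (by simpa [hsq'] using hK _ ha₀), hq.smul_eq_of_sub_mem ha₀,
      ← mul_tmul, ← smul_tmul, smul_comm]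
  let κ₀ : BaseChange f' M →+ BaseChange f M₀ := liftAdd
    (AddMonoidHom.mk' (fun b => AddMonoidHom.mk' (fun m => s b • tmul f 1 (q m))
        (fun m m' => by rw [map_add, tmul_add, smul_add]))
      (fun b b' => by ext m; exact hs_add b b' (tmul f 1 (q m))))
    (fun a b m => hbal a b m)
  have hκ₀_tmul : ∀ b m, κ₀ (tmul f' b m) = s b • tmul f 1 (q m) := fun _ _ => rfl
  have hκ₀ : ∀ b x, κ₀ (b • x) = s b • κ₀ x := by
    intro b x
    induction x using BaseChange.induction_on with
    | zero => simp
    | add x y hx hy => simp only [smul_add, map_add, hx, hy]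
    | tmul b' m => rw [smul_tmul, hκ₀_tmul, hκ₀_tmul, hs_mul _ _ _ _ (hs b)]
  have hκ₀_zero : ∀ x ∈ (K' • ⊤ : Submodule B' (BaseChange f' M)), κ₀ x = 0 := by
    intro x hx
    induction hx using Submodule.smul_induction_on' with
    | smul b hb x _ =>
      rw [hκ₀]
      exact hkill _ (by simpa using add_mem (hs b) hb) _
    | add x hx y hy h1 h2 => rw [map_add, h1, h2, add_zero]
  have hred : ∀ b (x : P), q' (b • x) = s b • q' x := fun b x => hq'.smul_eq_of_sub_mem (hs b) x
  constructor
  · rw [injective_iff_map_eq_zero]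
    -- Every `z` lifts along `κ₀` compatibly with `φ` and `φ₀`. If `φ₀` kills `z`, the lift is sent
    -- into `K' P`, so it lies in `K'` times the base change and `κ₀` kills it.
    have hlift : ∀ z : BaseChange f M₀, ∃ x : BaseChange f' M,
        q' (BaseChange.lift φ x) = BaseChange.lift φ₀ z ∧ κ₀ x = z := by
      intro z
      induction z using BaseChange.induction_on with
      | zero => exact ⟨0, by simp⟩
      | add x y hx hy =>
        obtain ⟨x', hx1, hx2⟩ := hx
        obtain ⟨y', hy1, hy2⟩ := hy
        exact ⟨x' + y', by simp [hx1, hy1], by rw [map_add, hx2, hy2]⟩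
      | tmul b m =>
        obtain ⟨m, rfl⟩ := hq.surjective m
        refine ⟨tmul f' (e' b) m, ?_, ?_⟩
        · rw [lift_tmul, lift_tmul, hq'.map_smul, hφ₀]
        · rw [hκ₀_tmul, ← sub_eq_zero, ← mul_one b, ← smul_tmul, mul_one, ← sub_smul]
          exact hkill _ (by simpa using hs (e' b)) _
    intro z hz
    obtain ⟨x, hx, rfl⟩ := hlift z
    rw [hz, hq'.eq_zero_iff] at hx
    refine hκ₀_zero x ?_
    have : (K' • ⊤ : Submodule B' P) = (K' • ⊤ : Submodule B' (BaseChange f' M)).map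
        (BaseChange.lift φ) := by
      rw [Submodule.map_smul'', Submodule.map_top, LinearMap.range_eq_top.2 hφ.2]
    rw [this] at hx
    obtain ⟨y, hy, hyx⟩ := hx
    exact hφ.1 hyx ▸ hy
  · intro y
    obtain ⟨y, rfl⟩ := hq'.surjective y
    obtain ⟨x, rfl⟩ := hφ.2 y
    induction x using BaseChange.induction_on with
    | zero => exact ⟨0, by simp⟩
    | add x y hx hy =>
      obtain ⟨x', hx⟩ := hx
      obtain ⟨y', hy⟩ := hy
      exact ⟨x' + y', by simp [hx, hy]⟩
    | tmul b m => exact ⟨tmul f (s b) (q m), by rw [lift_tmul, lift_tmul, hred, hφ₀]⟩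

/-- A lift of a map between reductions is linear over the big rings modulo the ideals. -/
theorem smul_eq_of_lift (hq : IsReduction e K q) (hq' : IsReduction e' K' q')
    (hsq : f'.comp e = e'.comp f) (hK : ∀ a ∈ K, f' a ∈ K') (hA : ∀ a', ∃ a, e a - a' ∈ K)
    (φ₀ : M₀ →ₛₗ[f] P₀) {m : M} {p : P} (h : q' p = φ₀ (q m)) (a : A') :
    q' (f' a • p) = φ₀ (q (a • m)) := by
  obtain ⟨a₀, ha₀⟩ := hA a
  have : f' (e a₀) = e' (f a₀) := congr($hsq a₀)
  rw [hq.smul_eq_of_sub_mem ha₀, φ₀.map_smulₛₗ, ← h,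
    hq'.smul_eq_of_sub_mem (by rw [← this, ← map_sub]; exact hK _ ha₀)]

end IsReduction

end Reduction

/-! ### Towers of reductions -/

section Tower

/-- Above level `n` the element is lifted step by step; below, it is projected. The induction shifts
the tower by one and recovers the bottom entry by `p 0`. -/
theorem exists_compatible_sequence (n : ℕ) : ∀ {X : ℕ → Type v} (p : ∀ n, X (n + 1) → X n)
    (_ : ∀ n, Function.Surjective (p n)) (y : X n),
    ∃ x : ∀ n, X n, (∀ n, p n (x (n + 1)) = x n) ∧ x n = y := by
  induction n with
  | zero =>
    intro X p hp y
    choose s hs using hp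
    exact ⟨fun n => Nat.rec y (fun n z => s n z) n, fun n => hs n _, rfl⟩
  | succ n ih =>
    intro X p hp y
    obtain ⟨x, hx, rfl⟩ := ih (X := fun k => X (k + 1)) (fun k => p (k + 1))
      (fun k => hp (k + 1)) y
    exact ⟨fun k => Nat.casesOn k (p 0 (x 0)) x, fun k => by cases k <;> simp [hx], rfl⟩

variable {A A' B B' : Type v} [CommRing A] [CommRing A'] [CommRing B] [CommRing B']

/-- The homomorphism `e : A →+* A'` behaves like the `c`-adic completion of a noetherian ring. -/
structure IsNoetherianCompletion (e : A →+* A') (c : Ideal A) : Prop where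
  isNoetherianRing : IsNoetherianRing A'
  isAdicComplete : IsAdicComplete (c.map e) A'
  dense (n : ℕ) (a' : A') : ∃ a, e a - a' ∈ c.map e ^ n
  mem_pow (n : ℕ) (a : A) : e a ∈ c.map e ^ n → a ∈ c ^ n

/-- The `X n` are the reductions of `M` modulo the powers of `c`, with transition maps `p n`. -/
structure IsReductionTower (e : A →+* A') (c : Ideal A) {M : Type v} {X : ℕ → Type v}
    [AddCommGroup M] [Module A' M] [∀ n, AddCommGroup (X n)] [∀ n, Module A (X n)]
    (q : ∀ n, M →+ X n) (p : ∀ n, X (n + 1) →ₗ[A] X n) : Prop where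
  isReduction (n : ℕ) : IsReduction e (c.map e ^ n) (q n)
  compat (n : ℕ) (m : M) : p n (q (n + 1) m) = q n m

variable {e : A →+* A'} {e' : B →+* B'} {f : A →+* B} {f' : A' →+* B'} {c : Ideal A} {d : Ideal B}
  {M P : Type v} {X Y : ℕ → Type v} [AddCommGroup M] [Module A' M] [AddCommGroup P] [Module B' P]
  [∀ n, AddCommGroup (X n)] [∀ n, Module A (X n)] [∀ n, AddCommGroup (Y n)] [∀ n, Module B (Y n)]
  {q : ∀ n, M →+ X n} {p : ∀ n, X (n + 1) →ₗ[A] X n}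
  {q' : ∀ n, P →+ Y n} {p' : ∀ n, Y (n + 1) →ₗ[B] Y n}

theorem pow_map_le_of_square (hsq : f'.comp e = e'.comp f) (hcd : c.map f = d) (n : ℕ) :
    ∀ a ∈ c.map e ^ n, f' a ∈ d.map e' ^ n := by
  intro a ha
  have := Ideal.mem_map_of_mem f' ha
  rwa [Ideal.map_pow, Ideal.map_map, hsq, ← Ideal.map_map, hcd] at this

/-- An element of `B` that becomes divisible by `d ^ n` in `B'` already lies in `d ^ n`, which is
the extension of `c ^ n`. This is the kernel condition needed in `IsReduction.isCocartesianMap`. -/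
theorem comap_pow_le_of_square (hd : IsNoetherianCompletion e' d) (hcd : c.map f = d) (n : ℕ) :
    (d.map e' ^ n).comap e' ≤ ((c.map e ^ n).comap e).map f := by
  intro b hb
  have hb' := hd.mem_pow n b hb
  rw [← hcd, ← Ideal.map_pow] at hb'
  refine Ideal.map_mono ?_ hb'
  rw [← Ideal.map_le_iff_le_comap, Ideal.map_pow]

namespace IsNoetherianCompletion

/-- Krull's intersection theorem: completeness places the extended ideal in the Jacobson radical of
the noetherian ring `A'`. -/
theorem isHausdorff (hc : IsNoetherianCompletion e c) (hM : Module.Finite A' M) :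
    IsHausdorff (c.map e) M :=
  have := hc.isNoetherianRing
  have := hc.isAdicComplete
  IsHausdorff.of_le_jacobson _ _ (IsAdicComplete.le_jacobson_bot _)

theorem eq_zero (hc : IsNoetherianCompletion e c) (hM : Module.Finite A' M) {m : M}
    (h : ∀ n, m ∈ (c.map e ^ n • ⊤ : Submodule A' M)) : m = 0 :=
  (hc.isHausdorff hM).haus m fun n => SModEq.zero.2 (h n)

/-- A map of finite modules is coCartesian if all its reductions are. -/
theorem isCocartesianMap (hd : IsNoetherianCompletion e' d)
    (hsq : f'.comp e = e'.comp f) (hcd : c.map f = d) (hM : Module.Finite A' M)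
    (hP : Module.Finite B' P) (hq : ∀ n, IsReduction e (c.map e ^ n) (q n))
    (hq' : ∀ n, IsReduction e' (d.map e' ^ n) (q' n)) {φ : M →ₛₗ[f'] P}
    {φ₀ : ∀ n, X n →ₛₗ[f] Y n} (hφ : ∀ n m, φ₀ n (q n m) = q' n (φ m))
    (h : ∀ n, IsCocartesianMap (φ₀ n)) : IsCocartesianMap φ := by
  have hN := hd.isNoetherianRing
  have hcompl := hd.isAdicComplete
  have hK := fun n => pow_map_le_of_square (e := e) (e' := e') hsq hcd n
  have hlift : ∀ n (w : BaseChange f (X n)), ∃ z : BaseChange f' M,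
      q' n (BaseChange.lift φ z) = BaseChange.lift (φ₀ n) w := by
    intro n w
    induction w using BaseChange.induction_on with
    | zero => exact ⟨0, by simp⟩
    | add x y hx hy =>
      obtain ⟨x', hx⟩ := hx
      obtain ⟨y', hy⟩ := hy
      exact ⟨x' + y', by simp [hx, hy]⟩
    | tmul b m =>
      obtain ⟨m, rfl⟩ := (hq n).surjective m
      exact ⟨BaseChange.tmul f' (e' b) m, by
        rw [BaseChange.lift_tmul, BaseChange.lift_tmul, (hq' n).map_smul, hφ]⟩
  constructor
  · rw [injective_iff_map_eq_zero]
    intro z hz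
    refine hd.eq_zero (BaseChange.finite f' hM) fun n => ?_
    -- The map `m ↦ 1 ⊗ m` descends to `ψ` from `X n` to the reduction `Q` of the base change. A
    -- single `w` in the base change of `X n` then represents both the image of `z` under `φ` and
    -- its class in `Q`; injectivity at level `n` gives `w = 0`.
    let θ : M →+ BaseChange f' M :=
      AddMonoidHom.mk' (fun m => BaseChange.tmul f' 1 m) fun m m' => BaseChange.tmul_add _ _ _
    obtain ⟨Q, r, hr⟩ := IsReduction.exists_of_ideal e' (d.map e' ^ n) (BaseChange f' M)
    obtain ⟨ψ, hψ⟩ := (hq n).exists_descend (f := f) (r.comp θ)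
      (fun a m => by
        have : f' (e a) = e' (f a) := congr($hsq a)
        simp only [θ, AddMonoidHom.comp_apply, AddMonoidHom.mk'_apply]
        rw [← BaseChange.mul_tmul, ← BaseChange.smul_tmul, this, hr.map_smul])
      (fun a ha m => by
        simp only [θ, AddMonoidHom.comp_apply, AddMonoidHom.mk'_apply]
        rw [← BaseChange.mul_tmul, ← BaseChange.smul_tmul, hr.smul_eq_zero (hK n a ha)])
    have hw : ∀ z : BaseChange f' M, ∃ w : BaseChange f (X n),
        BaseChange.lift (φ₀ n) w = q' n (BaseChange.lift φ z) ∧ BaseChange.lift ψ w = r z := by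
      intro z
      induction z using BaseChange.induction_on with
      | zero => exact ⟨0, by simp⟩
      | add x y hx hy =>
        obtain ⟨x', hx1, hx2⟩ := hx
        obtain ⟨y', hy1, hy2⟩ := hy
        exact ⟨x' + y', by simp [hx1, hy1], by simp [hx2, hy2]⟩
      | tmul b m =>
        obtain ⟨b₀, hb₀⟩ := hd.dense n b
        refine ⟨BaseChange.tmul f b₀ (q n m), ?_, ?_⟩
        · rw [BaseChange.lift_tmul, BaseChange.lift_tmul, (hq' n).smul_eq_of_sub_mem hb₀, hφ]
        · rw [BaseChange.lift_tmul, hψ, ← mul_one b, ← BaseChange.smul_tmul,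
            hr.smul_eq_of_sub_mem hb₀]
          rfl
    obtain ⟨w, hw1, hw2⟩ := hw z
    rw [hz, map_zero] at hw1
    have : w = 0 := (h n).1 (by rw [hw1, map_zero])
    rw [this, map_zero] at hw2
    exact (hr.eq_zero_iff _).1 hw2.symm
  -- Surjectivity modulo the first power suffices, by Nakayama's lemma.
  · rw [← LinearMap.range_eq_top, ← top_le_iff]
    refine Submodule.le_of_le_smul_of_le_jacobson_bot (I := d.map e') Module.Finite.fg_top
      (IsAdicComplete.le_jacobson_bot _) fun y _ => ?_
    obtain ⟨w, hw⟩ := (h 1).2 (q' 1 y)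
    obtain ⟨z, hz⟩ := hlift 1 w
    have := ((hq' 1).eq_iff y (BaseChange.lift φ z)).1 (hw.symm.trans hz.symm)
    rw [pow_one] at this
    exact Submodule.mem_sup.2 ⟨_, ⟨z, rfl⟩, _, this, by abel⟩

variable (X p) in
/-- The limit of a compatible tower of finite modules is finite and has the given reductions. -/
theorem exists_limit (hc : IsNoetherianCompletion e c) (hfin : Module.Finite A (X 1))
    (hkill : ∀ n, ∀ a ∈ c ^ n, ∀ x : X n, a • x = 0) (hsurj : ∀ n, Function.Surjective (p n))
    (hker : ∀ n x, p n x = 0 → x ∈ (c ^ n • ⊤ : Submodule A (X (n + 1)))) :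
    ∃ (L : ModuleCat.{v} A') (q : ∀ n, L →+ X n), Module.Finite A' L ∧
      IsReductionTower e c q p := by
  -- `A'` acts on the `n`-th coordinate through an approximation modulo the `n`-th power. The choice
  -- is immaterial because `c ^ n` kills `X n`, which also yields the module axioms and
  -- compatibility with `p`.
  choose s hs using hc.dense
  have hsmul : ∀ n a a' (x : X n), e a - a' ∈ c.map e ^ n → s n a' • x = a • x := by
    intro n a a' x h
    rw [← sub_eq_zero, ← sub_smul]
    refine hkill n _ (hc.mem_pow n _ ?_) x
    rw [map_sub]
    convert sub_mem (hs n a') h using 1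
    ring
  let Λ : AddSubgroup (∀ n, X n) :=
    { carrier := { x | ∀ n, p n (x (n + 1)) = x n }
      add_mem' := fun hx hy n => by simp [hx n, hy n]
      zero_mem' := fun n => by simp
      neg_mem' := fun hx n => by simp [hx n] }
  let _ : SMul A' Λ := ⟨fun a x => ⟨fun n => s n a • x.1 n, fun n => by
    rw [map_smul, x.2 n]
    exact (hsmul n _ a _ (Ideal.pow_le_pow_right n.le_succ (hs _ _))).symm⟩⟩
  have val_smul : ∀ (a : A') (x : Λ) n, (a • x).1 n = s n a • x.1 n := fun _ _ _ => rfl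
  have val_smul' : ∀ (a : A) (x : Λ) n, (e a • x).1 n = a • x.1 n := fun a x n => by
    rw [val_smul, hsmul n a _ _ (by simp)]
  have smul_ext : ∀ x y : Λ, (∀ n, x.1 n = y.1 n) → x = y := fun x y h => Subtype.ext (funext h)
  let _ : Module A' Λ :=
    { one_smul := fun x => smul_ext _ _ fun n => by
        rw [val_smul, hsmul n 1 1 _ (by simp), one_smul]
      mul_smul := fun a b x => smul_ext _ _ fun n => by
        rw [val_smul, val_smul, val_smul, ← mul_smul]
        refine hsmul n _ _ _ ?_
        have := add_mem (Ideal.mul_mem_right (e (s n b)) _ (hs n a)) (Ideal.mul_mem_left _ a (hs n b))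
        rw [map_mul]
        convert this using 1
        ring
      smul_zero := fun a => smul_ext _ _ fun n => smul_zero _
      smul_add := fun a x y => smul_ext _ _ fun n => smul_add _ _ _
      add_smul := fun a b x => smul_ext _ _ fun n => by
        change s n (a + b) • x.1 n = s n a • x.1 n + s n b • x.1 n
        rw [← add_smul]
        refine hsmul n _ _ _ ?_
        rw [map_add]
        convert add_mem (hs n a) (hs n b) using 1
        ring
      zero_smul := fun x => smul_ext _ _ fun n => by
        rw [val_smul, hsmul n 0 0 _ (by simp), zero_smul]
        rfl }
  -- The kernels of the projections. Identifying them with the adic filtration is exactly the claim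
  -- that the `X n` are the reductions of the limit.
  let F : ℕ → Submodule A' Λ := fun n =>
    { carrier := { x | x.1 n = 0 }
      add_mem' := fun {x y} hx hy => by
        change x.1 n + y.1 n = 0
        rw [hx, hy, add_zero]
      zero_mem' := rfl
      smul_mem' := fun a x hx => by
        change s n a • x.1 n = 0
        rw [hx, smul_zero] }
  have hF : ∀ n (x : Λ), x ∈ F n ↔ x.1 n = 0 := fun _ _ => Iff.rfl
  have hev : ∀ n, ∀ y : X n, ∃ x : Λ, x.1 n = y := fun n y => by
    obtain ⟨x, hx, hxy⟩ := exists_compatible_sequence n (fun n => p n) hsurj y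
    exact ⟨⟨x, hx⟩, hxy⟩
  have hlift : ∀ n, ∀ y ∈ (c ^ n • ⊤ : Submodule A (X (n + 1))),
      ∃ z ∈ (c.map e ^ n • ⊤ : Submodule A' Λ), z.1 (n + 1) = y := by
    intro n y hy
    induction hy using Submodule.smul_induction_on' with
    | smul a ha y _ =>
      obtain ⟨w, rfl⟩ := hev _ y
      refine ⟨e a • w, Submodule.smul_mem_smul ?_ trivial, val_smul' _ _ _⟩
      rw [← Ideal.map_pow]
      exact Ideal.mem_map_of_mem e ha
    | add x hx y hy h1 h2 =>
      obtain ⟨z, hz, rfl⟩ := h1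
      obtain ⟨w, hw, rfl⟩ := h2
      exact ⟨z + w, add_mem hz hw, rfl⟩
  -- Lifts of generators of `X 1` generate the limit modulo `F 1`, which is all that the
  -- approximation lemma asks for.
  obtain ⟨k, g, hg⟩ := Module.Finite.exists_fin (R := A) (M := X 1)
  choose w hw using fun i => hev 1 (g i)
  have hcompl := hc.isAdicComplete
  obtain ⟨hfinite, hFeq⟩ := finite_and_eq_smul_top_of_filtration (I := c.map e) (M := Λ)
    hcompl.toIsPrecomplete F
    (fun n x hx => by rw [hF, ← x.2 n, (hF _ _).1 hx, map_zero])
    (fun n => Submodule.smul_le.2 fun a ha x _ => by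
      rw [hF, val_smul, hsmul n 0 a _ (by simpa using ha), zero_smul])
    (fun n x hx => by
      obtain ⟨z, hz, hzx⟩ := hlift n (x.1 (n + 1)) (hker n _ ((x.2 n).trans hx))
      refine Submodule.mem_sup.2 ⟨z, hz, x - z, ?_, by abel⟩
      change x.1 (n + 1) - z.1 (n + 1) = 0
      rw [hzx, sub_self])
    (fun x hx => smul_ext _ _ hx)
    (by
      refine top_unique fun x _ => ?_
      -- `c ^ 0` is the unit ideal, so `X 0 = 0`.
      rw [hF, ← one_smul A (x.1 0)]
      exact hkill 0 1 (by simp) _)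
    (Submodule.span A' (Set.range w)) (Submodule.fg_span (Set.finite_range w))
    (by
      refine top_unique fun x _ => ?_
      have : x.1 1 ∈ Submodule.span A (Set.range g) := hg ▸ trivial
      obtain ⟨a, ha⟩ := (Submodule.mem_span_range_iff_exists_fun _).1 this
      let z : Λ := ∑ i, e (a i) • w i
      have hz : z.1 1 = x.1 1 := by
        have : z.1 1 = ∑ i, (e (a i) • w i).1 1 := by simp [z]
        rw [this, ← ha]
        exact Finset.sum_congr rfl fun i _ => by rw [val_smul', hw]
      refine Submodule.mem_sup.2 ⟨z, sum_mem fun i _ => Submodule.smul_mem _ _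
        (Submodule.subset_span ⟨i, rfl⟩), x - z, ?_, by abel⟩
      change x.1 1 - z.1 1 = 0
      rw [hz, sub_self])
  refine ⟨ModuleCat.of A' Λ, fun n => AddMonoidHom.mk' (fun x : Λ => x.1 n) fun _ _ => rfl,
    hfinite, fun n => ⟨fun a x => val_smul' a x n, hev n, fun x => ?_⟩, fun n x => x.2 n⟩
  exact (SetLike.ext_iff.1 (hFeq n) x)

end IsNoetherianCompletion

namespace IsReductionTower

theorem ext (ht : IsReductionTower e c q p) (hc : IsNoetherianCompletion e c)
    (hM : Module.Finite A' M) {x y : M} (h : ∀ n, q n x = q n y) : x = y := by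
  rw [← sub_eq_zero]
  exact hc.eq_zero hM fun n => ((ht.isReduction n).eq_iff _ _).1 (h n)

/-- Lifts of the entries form a Cauchy sequence, which converges since `M` is finite over a complete
ring. Together with `IsReductionTower.ext` this identifies `M` with the limit of its tower. -/
theorem exists_of_compat (ht : IsReductionTower e c q p) (hc : IsNoetherianCompletion e c)
    (hM : Module.Finite A' M) (x : ∀ n, X n) (hx : ∀ n, p n (x (n + 1)) = x n) :
    ∃ m, ∀ n, q n m = x n := by
  have hcompl := hc.isAdicComplete
  choose y hy using fun n => (ht.isReduction n).surjective (x n)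
  obtain ⟨m, hm⟩ := (hcompl.toIsPrecomplete.of_finite hM).exists_limit (f := y) fun n =>
    ((ht.isReduction n).eq_iff _ _).1 (by rw [← ht.compat, hy, hy, hx])
  exact ⟨m, fun n => by rw [← hy, ((ht.isReduction n).eq_iff (y n) m).2 (hm n)]⟩

/-- Compatible semilinear maps between reductions lift. -/
theorem exists_lift (ht : IsReductionTower e c q p) (ht' : IsReductionTower e' d q' p')
    (hc : IsNoetherianCompletion e c) (hd : IsNoetherianCompletion e' d)
    (hsq : f'.comp e = e'.comp f) (hcd : c.map f = d)
    (hP : Module.Finite B' P) (φ₀ : ∀ n, X n →ₛₗ[f] Y n)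
    (hφ₀ : ∀ n x, p' n (φ₀ (n + 1) x) = φ₀ n (p n x)) :
    ∃ φ : M →ₛₗ[f'] P, ∀ n m, q' n (φ m) = φ₀ n (q n m) := by
  choose φ hφ using fun m => ht'.exists_of_compat hd hP (fun n => φ₀ n (q n m)) fun n => by
    rw [hφ₀, ht.compat]
  refine ⟨{ toFun := φ, map_add' := fun x y => ?_, map_smul' := fun a x => ?_ }, fun n m => hφ m n⟩
  · exact ht'.ext hd hP fun n => by simp [hφ]
  · refine ht'.ext hd hP fun n => ?_
    rw [hφ]
    exact ((ht.isReduction n).smul_eq_of_lift (ht'.isReduction n) hsq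
      (pow_map_le_of_square hsq hcd n) (hc.dense n) (φ₀ n) (hφ x n) a).symm

end IsReductionTower

end Tower

/-! ### Descent in terms of coCartesian maps over a morphism of diagrams -/

section CartesianDescent

theorem BaseChange.lift_map {A B A' B' : Type v} [CommRing A] [CommRing B] [CommRing A']
    [CommRing B'] {f : A →+* B} {f' : A' →+* B'} {g : A →+* A'} {g' : B →+* B'}
    (h : f'.comp g = g'.comp f) {M M' P P' : Type v} [AddCommGroup M] [Module A M]
    [AddCommGroup M'] [Module A' M'] [AddCommGroup P] [Module B P] [AddCommGroup P'] [Module B' P']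
    {φ : M →ₛₗ[g] M'} {ψ : P →ₛₗ[g'] P'} {θ : M →ₛₗ[f] P} {θ' : M' →ₛₗ[f'] P'}
    (hsq : ∀ m, θ' (φ m) = ψ (θ m)) (x : BaseChange f M) :
    BaseChange.lift θ' (BaseChange.map h φ x) = ψ (BaseChange.lift θ x) := by
  induction x using BaseChange.induction_on with
  | zero => simp
  | add x y hx hy => simp only [map_add, hx, hy]
  | tmul b m => rw [map_tmul, lift_tmul, lift_tmul, hsq, ψ.map_smulₛₗ]

variable {I : Type u₁} [Category.{v₁} I] {J : Type u₂} [Category.{v₂} J]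
  {S : I ⥤ CommRingCat.{v}} {T : J ⥤ CommRingCat.{v}}

namespace DiagMod

@[simp]
theorem comp_app {M N P : DiagMod S} (φ : M ⟶ N) (ψ : N ⟶ P) (i : I) (x : M.obj i) :
    Hom.app (φ ≫ ψ) i x = Hom.app ψ i (Hom.app φ i x) := rfl

@[simp]
theorem id_app (M : DiagMod S) (i : I) (x : M.obj i) : Hom.app (𝟙 M) i x = x := rfl

theorem hom_app_ext {M N : DiagMod S} {φ ψ : M ⟶ N}
    (h : ∀ i x, Hom.app φ i x = Hom.app ψ i x) : φ = ψ :=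
  hom_ext fun i => LinearMap.ext (h i)

/-- A morphism with bijective components is an isomorphism. -/
noncomputable def isoOfBijective {M N : DiagMod S} (φ : M ⟶ N)
    (h : ∀ i, Function.Bijective (Hom.app φ i)) : M ≅ N where
  hom := φ
  inv :=
    { app := fun i => (LinearEquiv.ofBijective (Hom.app φ i) (h i)).symm
      naturality := fun {i j} ρ x => by
        obtain ⟨x, rfl⟩ := (h i).2 x
        apply (h j).1
        have h1 : ∀ i x, (LinearEquiv.ofBijective (Hom.app φ i) (h i)).symm (Hom.app φ i x) = x :=
          fun i x => LinearEquiv.ofBijective_symm_apply_apply _ x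
        rw [← Hom.naturality φ]
        simp only [LinearEquiv.coe_coe, h1] }
  hom_inv_id := hom_app_ext fun i x =>
    (LinearEquiv.ofBijective (Hom.app φ i) (h i)).symm_apply_apply x
  inv_hom_id := hom_app_ext fun i x =>
    (LinearEquiv.ofBijective (Hom.app φ i) (h i)).apply_symm_apply x

theorem bijective_app_of_iso {M N : DiagMod S} (e : M ≅ N) (i : I) :
    Function.Bijective (Hom.app e.hom i) :=
  Function.bijective_iff_has_inverse.2 ⟨Hom.app e.inv i,
    fun x => by rw [← comp_app, e.hom_inv_id, id_app],
    fun x => by rw [← comp_app, e.inv_hom_id, id_app]⟩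

/-- A natural family of coCartesian maps `M (α i) → N i`: it exhibits `N` as the pull-back
of `M`. -/
structure CocartesianOver (α : I ⥤ J) (μ : α ⋙ T ⟶ S) (M : DiagMod T) (N : DiagMod S) where
  app (i : I) : M.obj (α.obj i) →ₛₗ[(μ.app i).hom] N.obj i
  naturality {i j : I} (ρ : i ⟶ j) (x : M.obj (α.obj i)) :
    app j (M.map (α.map ρ) x) = N.map ρ (app i x)
  isCocartesianMap (i : I) : IsCocartesianMap (app i)

namespace CocartesianOver

variable {α : I ⥤ J} {μ : α ⋙ T ⟶ S} {M M' : DiagMod T} {N N' : DiagMod S}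

variable (α μ M) in
/-- The tautological map to the pull-back. -/
noncomputable def toPullback : CocartesianOver α μ M ((pullback α μ).obj M) where
  app i :=
    { toFun := fun x => BaseChange.tmul (μ.app i).hom 1 x
      map_add' := fun x y => BaseChange.tmul_add _ _ _
      map_smul' := fun a x => by
        rw [← BaseChange.mul_tmul]
        exact (BaseChange.smul_tmul _ _ _).symm }
  naturality ρ x := congrArg (fun b => BaseChange.tmul _ b _) (map_one _).symm
  isCocartesianMap i := by
    refine (congrArg Function.Bijective (funext fun x => ?_)).mpr Function.bijective_id
    induction x using BaseChange.induction_on with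
    | zero => exact map_zero _
    | add x y hx hy => exact (map_add _ _ _).trans (congr_arg₂ (· + ·) hx hy)
    | tmul b m => exact congrArg (fun b => BaseChange.tmul _ b m) (mul_one b)

theorem pullback_hom_ext {φ ψ : (pullback α μ).obj M ⟶ N}
    (h : ∀ i x, Hom.app φ i ((toPullback α μ M).app i x) =
      Hom.app ψ i ((toPullback α μ M).app i x)) : φ = ψ := by
  refine hom_app_ext fun i x => ?_
  induction x using BaseChange.induction_on with
  | zero => exact (map_zero _).trans (map_zero _).symm
  | add x y hx hy =>
    exact (map_add _ _ _).trans ((congr_arg₂ (· + ·) hx hy).trans (map_add _ _ _).symm)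
  | tmul b m =>
    have hb : BaseChange.tmul (μ.app i).hom b m = b • (toPullback α μ M).app i m :=
      congrArg (fun b => BaseChange.tmul _ b m) (mul_one b).symm
    rw [hb]
    exact (map_smul _ _ _).trans ((congrArg (b • ·) (h i m)).trans (map_smul _ _ _).symm)

/-- The comparison map from the pull-back. -/
noncomputable def fromPullback (θ : CocartesianOver α μ M N) : (pullback α μ).obj M ⟶ N where
  app i := BaseChange.lift (θ.app i)
  naturality ρ x := BaseChange.lift_map (square μ ρ) (θ.naturality ρ) x

/-- The identification of the target with the pull-back. -/
noncomputable def isoPullback (θ : CocartesianOver α μ M N) : (pullback α μ).obj M ≅ N :=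
  isoOfBijective θ.fromPullback θ.isCocartesianMap

theorem isoPullback_hom_app (θ : CocartesianOver α μ M N) (i : I) (x : M.obj (α.obj i)) :
    Hom.app θ.isoPullback.hom i ((toPullback α μ M).app i x) = θ.app i x :=
  (BaseChange.lift_tmul (θ.app i) 1 x).trans (one_smul _ _)

/-- Postcomposition with an isomorphism. -/
noncomputable def compIso (θ : CocartesianOver α μ M N) (e : N ≅ N') :
    CocartesianOver α μ M N' where
  app i := (Hom.app e.hom i).comp (θ.app i)
  naturality ρ x := by
    simp only [LinearMap.comp_apply, θ.naturality, Hom.naturality]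
  isCocartesianMap i := by
    have : ⇑(BaseChange.lift ((Hom.app e.hom i).comp (θ.app i))) =
        Hom.app e.hom i ∘ BaseChange.lift (θ.app i) := by
      funext x
      induction x using BaseChange.induction_on with
      | zero => simp
      | add x y hx hy => simpa using congr_arg₂ (· + ·) hx hy
      | tmul b m => simp
    rw [IsCocartesianMap, this]
    exact (bijective_app_of_iso e i).comp (θ.isCocartesianMap i)

/-- Translates "`φ` pulls back to `ψ`" into a commutation condition on elements, so that any model
of the pull-back may be used in place of the tensor product. -/
theorem app_eq_iff (θ : CocartesianOver α μ M N) (θ' : CocartesianOver α μ M' N') (φ : M ⟶ M')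
    (ψ : N ⟶ N') :
    (∀ i x, θ'.app i (Hom.app φ (α.obj i) x) = Hom.app ψ i (θ.app i x)) ↔
      (pullback α μ).map φ = θ.isoPullback.hom ≫ ψ ≫ θ'.isoPullback.inv := by
  rw [← Category.assoc, Iso.eq_comp_inv]
  have key : ∀ i x, Hom.app ((pullback α μ).map φ ≫ θ'.isoPullback.hom) i
      ((toPullback α μ M).app i x) = θ'.app i (Hom.app φ (α.obj i) x) := fun i x =>
    isoPullback_hom_app θ' i (Hom.app φ (α.obj i) x)
  constructor
  · intro h
    refine pullback_hom_ext fun i x => ?_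
    rw [key, h, comp_app, isoPullback_hom_app]
  · intro h i x
    rw [← key, h, comp_app, isoPullback_hom_app]

end CocartesianOver

variable {α : I ⥤ J} {μ : α ⋙ T ⟶ S}

/-- Full faithfulness of pull-back, stated for arbitrary models of the pull-backs. -/
theorem _root_.IsOfFiniteDescent.existsUnique (h : IsOfFiniteDescent α μ) {M M' : DiagMod T}
    {N N' : DiagMod S} (hM : finiteCocartesian T M) (hM' : finiteCocartesian T M')
    (θ : CocartesianOver α μ M N) (θ' : CocartesianOver α μ M' N') (ψ : N ⟶ N') :
    ∃! φ : M ⟶ M', ∀ i x, θ'.app i (Hom.app φ (α.obj i) x) = Hom.app ψ i (θ.app i x) := by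
  have : (pullbackFiniteCocartesian α μ).IsEquivalence := h
  simp only [CocartesianOver.app_eq_iff]
  let X : (finiteCocartesian T).FullSubcategory := ⟨M, hM⟩
  let X' : (finiteCocartesian T).FullSubcategory := ⟨M', hM'⟩
  let g : (pullbackFiniteCocartesian α μ).obj X ⟶ (pullbackFiniteCocartesian α μ).obj X' :=
    ObjectProperty.homMk (θ.isoPullback.hom ≫ ψ ≫ θ'.isoPullback.inv)
  refine ⟨((pullbackFiniteCocartesian α μ).preimage g).hom, ?_, fun φ hφ => ?_⟩
  · exact congrArg (finiteCocartesian S).ι.map ((pullbackFiniteCocartesian α μ).map_preimage g)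
  · have : (ObjectProperty.homMk φ : X ⟶ X') = (pullbackFiniteCocartesian α μ).preimage g := by
      apply (pullbackFiniteCocartesian α μ).map_injective
      rw [Functor.map_preimage]
      exact ObjectProperty.hom_ext _ hφ
    exact congrArg InducedCategory.Hom.hom this

theorem _root_.IsOfFiniteDescent.exists_cocartesianOver (h : IsOfFiniteDescent α μ)
    {N : DiagMod S} (hN : finiteCocartesian S N) :
    ∃ M, finiteCocartesian T M ∧ Nonempty (CocartesianOver α μ M N) := by
  have : (pullbackFiniteCocartesian α μ).IsEquivalence := h
  let Y : (finiteCocartesian S).FullSubcategory := ⟨N, hN⟩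
  let X := (pullbackFiniteCocartesian α μ).objPreimage Y
  exact ⟨X.obj, X.property, ⟨(CocartesianOver.toPullback α μ X.obj).compIso
    ((finiteCocartesian S).ι.mapIso ((pullbackFiniteCocartesian α μ).objObjPreimageIso Y))⟩⟩

/-- Applying `hff` to the tautological maps into the pull-backs gives full faithfulness; `hes` gives
essential surjectivity. -/
theorem _root_.isOfFiniteDescent_of_cocartesianOver
    (hff : ∀ {M M' : DiagMod T} {N N' : DiagMod S}, finiteCocartesian T M →
      finiteCocartesian T M' → finiteCocartesian S N → finiteCocartesian S N' →
      ∀ (θ : CocartesianOver α μ M N) (θ' : CocartesianOver α μ M' N') (ψ : N ⟶ N'),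
      ∃! φ : M ⟶ M', ∀ i x, θ'.app i (Hom.app φ (α.obj i) x) = Hom.app ψ i (θ.app i x))
    (hes : ∀ {N : DiagMod S}, finiteCocartesian S N →
      ∃ M, finiteCocartesian T M ∧ Nonempty (CocartesianOver α μ M N)) :
    IsOfFiniteDescent α μ := by
  have huniq : ∀ (X X' : (finiteCocartesian T).FullSubcategory)
      (ψ : (pullback α μ).obj X.obj ⟶ (pullback α μ).obj X'.obj),
      ∃! φ : X.obj ⟶ X'.obj, (pullback α μ).map φ = ψ := by
    intro X X' ψ
    let θ := CocartesianOver.toPullback α μ X.obj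
    let θ' := CocartesianOver.toPullback α μ X'.obj
    have := hff X.property X'.property (finiteCocartesian_pullback α μ _ X.property)
      (finiteCocartesian_pullback α μ _ X'.property) θ θ'
      (θ.isoPullback.inv ≫ ψ ≫ θ'.isoPullback.hom)
    simpa only [CocartesianOver.app_eq_iff, Category.assoc, Iso.hom_inv_id, Category.comp_id,
      Iso.hom_inv_id_assoc] using this
  exact
    { faithful := ⟨fun {X X' φ φ'} h => ObjectProperty.hom_ext _
        ((huniq X X' ((pullback α μ).map φ'.hom)).unique
          (congrArg (finiteCocartesian S).ι.map h) rfl)⟩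
      full := ⟨fun {X X'} ψ => by
        obtain ⟨φ, hφ, -⟩ := huniq X X' ψ.hom
        exact ⟨ObjectProperty.homMk φ, ObjectProperty.hom_ext _ hφ⟩⟩
      essSurj := ⟨fun Y => by
        obtain ⟨M, hM, ⟨θ⟩⟩ := hes Y.property
        exact ⟨⟨M, hM⟩, ⟨ObjectProperty.isoMk _ θ.isoPullback⟩⟩⟩ }

end DiagMod

end CartesianDescent

/-! ### Reductions of modules over diagrams -/

section DiagramReduction

variable {I : Type u₁} [Category.{v₁} I] {J : Type u₂} [Category.{v₂} J]
  {S S' : I ⥤ CommRingCat.{v}} {T T' : J ⥤ CommRingCat.{v}}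

namespace DiagMod

theorem comp_naturality (ι : S ⟶ S') {i j : I} (ρ : i ⟶ j) :
    (S'.map ρ).hom.comp (ι.app i).hom = (ι.app j).hom.comp (S.map ρ).hom :=
  (congrArg CommRingCat.Hom.hom (ι.naturality ρ)).symm

/-- `X` is the reduction of the `(I, S')`-module `M` modulo a family of ideals, viewed as an
`(I, S)`-module. -/
structure Reduction (ι : S ⟶ S') (K : ∀ i, Ideal (S'.obj i)) (M : DiagMod S') (X : DiagMod S) where
  q (i : I) : M.obj i →+ X.obj i
  naturality {i j : I} (ρ : i ⟶ j) (x : M.obj i) : q j (M.map ρ x) = X.map ρ (q i x)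
  isReduction (i : I) : IsReduction (ι.app i).hom (K i) (q i)

namespace Reduction

variable {ι : S ⟶ S'} {κ : T ⟶ T'} {K K' : ∀ i, Ideal (S'.obj i)} {L : ∀ j, Ideal (T'.obj j)}
  {M M' : DiagMod S'} {X X' : DiagMod S} {P : DiagMod T'} {Y : DiagMod T}

variable (ι K M) in
theorem exists_of_ideal (hK : ∀ {i j : I} (ρ : i ⟶ j), ∀ a ∈ K i, (S'.map ρ).hom a ∈ K j) :
    ∃ X, Nonempty (Reduction ι K M X) := by
  choose X q hq using fun i => IsReduction.exists_of_ideal (ι.app i).hom (K i) (M.obj i)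
  choose m hm using fun {i j : I} (ρ : i ⟶ j) =>
    (hq i).exists_map (hq j) (comp_naturality ι ρ) (hK ρ) (M.map ρ)
  exact ⟨
    { obj := X
      map := m
      map_id := fun i x => by
        obtain ⟨x, rfl⟩ := (hq i).surjective x
        rw [hm, M.map_id]
      map_comp := fun {i j k} ρ σ x => by
        obtain ⟨x, rfl⟩ := (hq i).surjective x
        rw [hm, hm, hm, M.map_comp] }, ⟨⟨q, fun ρ x => (hm ρ x).symm, hq⟩⟩⟩

theorem exists_map (r : Reduction ι K M X) (r' : Reduction ι K' M' X') (hK : ∀ i, K i ≤ K' i)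
    (φ : M ⟶ M') : ∃ ψ : X ⟶ X', ∀ i x, Hom.app ψ i (r.q i x) = r'.q i (Hom.app φ i x) := by
  choose ψ hψ using fun i => (r.isReduction i).exists_map (f := RingHom.id _) (f' := RingHom.id _)
    (r'.isReduction i) rfl (fun a ha => hK i ha) (Hom.app φ i)
  refine ⟨⟨ψ, fun {i j} ρ x => ?_⟩, hψ⟩
  obtain ⟨x, rfl⟩ := (r.isReduction i).surjective x
  rw [← r.naturality, hψ, hψ, Hom.naturality, r'.naturality]

theorem exists_cocartesianOver {α : J ⥤ I} {μ : α ⋙ S ⟶ T} {μ' : α ⋙ S' ⟶ T'}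
    (r : Reduction ι K M X) (s : Reduction κ L P Y)
    (hsq : ∀ j, (μ'.app j).hom.comp (ι.app (α.obj j)).hom = (κ.app j).hom.comp (μ.app j).hom)
    (hK : ∀ j, ∀ a ∈ K (α.obj j), (μ'.app j).hom a ∈ L j)
    (hS : ∀ i a', ∃ a, (ι.app i).hom a - a' ∈ K i)
    (hT : ∀ i a', ∃ a, (κ.app i).hom a - a' ∈ L i)
    (hker : ∀ j, (L j).comap (κ.app j).hom ≤
      ((K (α.obj j)).comap (ι.app (α.obj j)).hom).map (μ.app j).hom)
    (θ : CocartesianOver α μ' M P) : ∃ θ₀ : CocartesianOver α μ X Y,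
      ∀ j x, θ₀.app j (r.q (α.obj j) x) = s.q j (θ.app j x) := by
  choose ψ hψ using fun j => (r.isReduction (α.obj j)).exists_map (s.isReduction j) (hsq j)
    (hK j) (θ.app j)
  refine ⟨⟨ψ, fun {i j} ρ x => ?_, fun j => ?_⟩, hψ⟩
  · obtain ⟨x, rfl⟩ := (r.isReduction _).surjective x
    rw [← r.naturality, hψ, hψ, θ.naturality, s.naturality]
  · exact (r.isReduction (α.obj j)).isCocartesianMap (s.isReduction j) (hsq j) (hK j)
      (hS (α.obj j)) (hT j) (hker j) (hψ j) (θ.isCocartesianMap j)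

theorem finiteCocartesian (r : Reduction ι K M X)
    (hK : ∀ {i j : I} (ρ : i ⟶ j), ∀ a ∈ K i, (S'.map ρ).hom a ∈ K j)
    (hS : ∀ i a', ∃ a, (ι.app i).hom a - a' ∈ K i)
    (hker : ∀ {i j : I} (ρ : i ⟶ j), (K j).comap (ι.app j).hom ≤
      ((K i).comap (ι.app i).hom).map (S.map ρ).hom)
    (hM : DiagMod.finiteCocartesian S' M) : DiagMod.finiteCocartesian S X :=
  ⟨fun i => (r.isReduction i).finite (hS i) (hM.1 i), fun i j ρ =>
    (r.isReduction i).isCocartesianMap (r.isReduction j) (comp_naturality ι ρ) (hK ρ)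
      (hS i) (hS j) (hker ρ) (fun m => (r.naturality ρ m).symm) (hM.2 ρ)⟩

end Reduction

/-- The diagram `S'` behaves like the completion of the diagram `S` at the ideals `c i`. -/
structure IsCompletion (ι : S ⟶ S') (c : ∀ i, Ideal (S.obj i)) : Prop where
  isNoetherianCompletion (i : I) : IsNoetherianCompletion (ι.app i).hom (c i)
  map_eq {i j : I} (ρ : i ⟶ j) : (c i).map (S.map ρ).hom = c j

/-- The powers of the extensions of the ideals `c i`. -/
abbrev extPow (ι : S ⟶ S') (c : ∀ i, Ideal (S.obj i)) (n : ℕ) (i : I) : Ideal (S'.obj i) :=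
  (c i).map (ι.app i).hom ^ n

/-- The tower of reductions of a module modulo the powers of the ideals `c i`. -/
structure ReductionTower (ι : S ⟶ S') (c : ∀ i, Ideal (S.obj i)) (M : DiagMod S')
    (X : ℕ → DiagMod S) (p : ∀ n, X (n + 1) ⟶ X n) where
  red (n : ℕ) : Reduction ι (extPow ι c n) M (X n)
  compat (n : ℕ) (i : I) (m : M.obj i) : Hom.app (p n) i ((red (n + 1)).q i m) = (red n).q i m

namespace ReductionTower

variable {ι : S ⟶ S'} {c : ∀ i, Ideal (S.obj i)} {M M' : DiagMod S'} {X X' : ℕ → DiagMod S}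
  {p : ∀ n, X (n + 1) ⟶ X n} {p' : ∀ n, X' (n + 1) ⟶ X' n}

theorem isReductionTower (t : ReductionTower ι c M X p) (i : I) :
    IsReductionTower (ι.app i).hom (c i) (fun n => (t.red n).q i) (fun n => Hom.app (p n) i) :=
  ⟨fun n => (t.red n).isReduction i, fun n m => t.compat n i m⟩

variable (M) in
theorem exists_tower (h : IsCompletion ι c) : ∃ X p, Nonempty (ReductionTower ι c M X p) := by
  choose X r using fun n => Reduction.exists_of_ideal ι (extPow ι c n) M fun ρ =>
    pow_map_le_of_square (comp_naturality ι ρ) (h.map_eq ρ) n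
  choose p hp using fun n => (r (n + 1)).some.exists_map (r n).some
    (fun i => Ideal.pow_le_pow_right n.le_succ) (𝟙 M)
  exact ⟨X, p, ⟨⟨fun n => (r n).some, fun n i m => hp n i m⟩⟩⟩

theorem finiteCocartesian (t : ReductionTower ι c M X p) (h : IsCompletion ι c)
    (hM : DiagMod.finiteCocartesian S' M) (n : ℕ) : DiagMod.finiteCocartesian S (X n) :=
  (t.red n).finiteCocartesian
    (fun ρ => pow_map_le_of_square (comp_naturality ι ρ) (h.map_eq ρ) n)
    (fun i => (h.isNoetherianCompletion i).dense n)
    (fun {_ j} ρ => comap_pow_le_of_square (h.isNoetherianCompletion j) (h.map_eq ρ) n) hM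

/-- Compatible morphisms between the reductions lift. -/
theorem exists_hom (t : ReductionTower ι c M X p) (t' : ReductionTower ι c M' X' p')
    (h : IsCompletion ι c) (hM' : M'.IsFinite) (φ₀ : ∀ n, X n ⟶ X' n)
    (hφ₀ : ∀ n, φ₀ (n + 1) ≫ p' n = p n ≫ φ₀ n) :
    ∃ φ : M ⟶ M', ∀ n i x, (t'.red n).q i (Hom.app φ i x) = Hom.app (φ₀ n) i ((t.red n).q i x) := by
  choose φ hφ using fun i => (t.isReductionTower i).exists_lift (t'.isReductionTower i)
    (h.isNoetherianCompletion i) (h.isNoetherianCompletion i) (f := RingHom.id _)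
    (f' := RingHom.id _) rfl (Ideal.map_id _) (hM' i) (fun n => Hom.app (φ₀ n) i)
    (fun n x => by rw [← comp_app, hφ₀, comp_app])
  refine ⟨⟨φ, fun {i j} ρ x => ?_⟩, fun n i x => hφ i n x⟩
  refine (t'.isReductionTower j).ext (h.isNoetherianCompletion j) (hM' j) fun n => ?_
  rw [hφ, (t.red n).naturality, Hom.naturality, ← hφ, (t'.red n).naturality]

variable (X p) in
/-- A compatible tower of finite coCartesian modules is the tower of reductions of its limit. -/
theorem exists_limit (h : IsCompletion ι c) (hX : ∀ n, DiagMod.finiteCocartesian S (X n))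
    (hkill : ∀ n i, ∀ a ∈ c i ^ n, ∀ x : (X n).obj i, a • x = 0)
    (hsurj : ∀ n i, Function.Surjective (Hom.app (p n) i))
    (hker : ∀ n i x, Hom.app (p n) i x = 0 →
      x ∈ (c i ^ n • ⊤ : Submodule (S.obj i) ((X (n + 1)).obj i))) :
    ∃ M, DiagMod.finiteCocartesian S' M ∧ Nonempty (ReductionTower ι c M X p) := by
  choose M q hfin ht using fun i => (h.isNoetherianCompletion i).exists_limit
    (fun n => (X n).obj i) (fun n => Hom.app (p n) i) ((hX 1).1 i) (fun n => hkill n i)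
    (fun n => hsurj n i) (fun n => hker n i)
  choose m hm using fun {i j : I} (ρ : i ⟶ j) => (ht i).exists_lift (ht j)
    (h.isNoetherianCompletion i) (h.isNoetherianCompletion j) (comp_naturality ι ρ) (h.map_eq ρ)
    (hfin j) (fun n => (X n).map ρ) (fun n x => Hom.naturality (p n) ρ x)
  have hext := fun i {x y : M i} => (ht i).ext (h.isNoetherianCompletion i) (hfin i) (x := x) (y := y)
  let N : DiagMod S' :=
    { obj := M
      map := m
      map_id := fun i x => hext i fun n => by rw [hm, (X n).map_id]
      map_comp := fun {i j k} ρ σ x => hext k fun n => by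
        rw [hm, hm, hm, (X n).map_comp] }
  refine ⟨N, ⟨hfin, fun i j ρ => ?_⟩,
    ⟨⟨fun n => ⟨fun i => q i n, fun ρ x => hm ρ n x, fun i => (ht i).isReduction n⟩,
      fun n i x => (ht i).compat n x⟩⟩⟩
  exact (h.isNoetherianCompletion j).isCocartesianMap (comp_naturality ι ρ) (h.map_eq ρ)
    (hfin i) (hfin j) (ht i).isReduction (ht j).isReduction (fun n x => (hm ρ n x).symm)
    fun n => (hX n).2 ρ

/-- The transition maps of a tower of reductions are themselves reductions. -/
theorem isReduction_transition (t : ReductionTower ι c M X p) (h : IsCompletion ι c) (n : ℕ)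
    (i : I) : IsReduction (RingHom.id (S.obj i)) (c i ^ n) (Hom.app (p n) i).toAddMonoidHom where
  map_smul a x := map_smul (Hom.app (p n) i) a x
  surjective x := by
    obtain ⟨m, rfl⟩ := ((t.red n).isReduction i).surjective x
    exact ⟨_, t.compat n i m⟩
  eq_zero_iff x := by
    have hr := (t.red n).isReduction i
    have hr' := (t.red (n + 1)).isReduction i
    constructor
    · intro hx
      obtain ⟨m, rfl⟩ := hr'.surjective x
      have hm := (hr.eq_zero_iff m).1 ((t.compat n i m).symm.trans hx)
      clear hx
      induction hm using Submodule.smul_induction_on' with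
      | smul a ha m _ =>
        -- Precision `n + 1` is needed for `a₀` to act like `a` on the reduction at level `n + 1`;
        -- precision `n` is enough for `a₀ ∈ c i ^ n`.
        obtain ⟨a₀, ha₀⟩ := (h.isNoetherianCompletion i).dense (n + 1) a
        rw [hr'.smul_eq_of_sub_mem ha₀]
        refine Submodule.smul_mem_smul ((h.isNoetherianCompletion i).mem_pow n _ ?_) trivial
        simpa using add_mem (Ideal.pow_le_pow_right n.le_succ ha₀) ha
      | add x hx y hy h1 h2 => rw [map_add]; exact add_mem h1 h2
    · intro hx
      induction hx using Submodule.smul_induction_on' with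
      | smul a ha x _ =>
        refine (map_smul (Hom.app (p n) i) a x).trans ?_
        obtain ⟨m, hm⟩ := hr.surjective (Hom.app (p n) i x)
        rw [← hm, ← hr.map_smul]
        refine hr.smul_eq_zero ?_ m
        rw [extPow, ← Ideal.map_pow]
        exact Ideal.mem_map_of_mem _ ha
      | add x hx y hy h1 h2 => rw [map_add, h1, h2, add_zero]

end ReductionTower

end DiagMod

end DiagramReduction

/-! ### Descent passes to completions -/

section CompletedDescent

variable {I : Type u₁} [Category.{v₁} I] {J : Type u₂} [Category.{v₂} J]
  {S S' : I ⥤ CommRingCat.{v}} {T T' : J ⥤ CommRingCat.{v}}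

namespace DiagMod

theorem Reduction.exists_hom {K : ∀ j, Ideal (T.obj j)} {M X : DiagMod T}
    (r : Reduction (𝟙 T) K M X) : ∃ p : M ⟶ X, ∀ j x, Hom.app p j x = r.q j x :=
  ⟨⟨fun j => { r.q j with map_smul' := fun a x => (r.isReduction j).map_smul a x },
    r.naturality⟩, fun _ _ => rfl⟩

variable {α : I ⥤ J} {μ : α ⋙ T ⟶ S} {μ' : α ⋙ T' ⟶ S'}

/-- The identity of `N` descends in both directions, and uniqueness forces the two composites to be
identities. -/
theorem _root_.IsOfFiniteDescent.exists_iso (h : IsOfFiniteDescent α μ) {M M' : DiagMod T}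
    {N : DiagMod S} (hM : finiteCocartesian T M) (hM' : finiteCocartesian T M')
    (θ : CocartesianOver α μ M N) (θ' : CocartesianOver α μ M' N) :
    ∃ e : M ≅ M', ∀ i x, θ'.app i (Hom.app e.hom (α.obj i) x) = θ.app i x := by
  obtain ⟨f, hf, -⟩ := h.existsUnique hM hM' θ θ' (𝟙 N)
  obtain ⟨g, hg, -⟩ := h.existsUnique hM' hM θ' θ (𝟙 N)
  simp only [id_app] at hf hg
  refine ⟨⟨f, g, (h.existsUnique hM hM θ θ (𝟙 N)).unique ?_ ?_,
    (h.existsUnique hM' hM' θ' θ' (𝟙 N)).unique ?_ ?_⟩, hf⟩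
  all_goals intro i x; simp only [comp_app, id_app, hf, hg]

variable {κ : T ⟶ T'} {ι : S ⟶ S'} {c : ∀ i, Ideal (S.obj i)} {d : ∀ j, Ideal (T.obj j)}

theorem ReductionTower.exists_cocartesianOver {M : DiagMod T'} {N : DiagMod S'}
    {X : ℕ → DiagMod T} {Y : ℕ → DiagMod S} {p : ∀ n, X (n + 1) ⟶ X n} {r : ∀ n, Y (n + 1) ⟶ Y n}
    (t : ReductionTower κ d M X p) (s : ReductionTower ι c N Y r)
    (hT : IsCompletion κ d) (hS : IsCompletion ι c)
    (hsq : ∀ i, (μ'.app i).hom.comp (κ.app (α.obj i)).hom = (ι.app i).hom.comp (μ.app i).hom)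
    (hdc : ∀ i, (d (α.obj i)).map (μ.app i).hom = c i) (θ : CocartesianOver α μ' M N) :
    ∃ θ₀ : ∀ n, CocartesianOver α μ (X n) (Y n),
      (∀ n i x, (θ₀ n).app i ((t.red n).q (α.obj i) x) = (s.red n).q i (θ.app i x)) ∧
      ∀ n i x, (θ₀ n).app i (Hom.app (p n) (α.obj i) x) =
        Hom.app (r n) i ((θ₀ (n + 1)).app i x) := by
  choose θ₀ hθ₀ using fun n => (t.red n).exists_cocartesianOver (s.red n) hsq
    (fun i => pow_map_le_of_square (hsq i) (hdc i) n)
    (fun j => (hT.isNoetherianCompletion j).dense n)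
    (fun i => (hS.isNoetherianCompletion i).dense n)
    (fun i => comap_pow_le_of_square (hS.isNoetherianCompletion i) (hdc i) n) θ
  refine ⟨θ₀, hθ₀, fun n i x => ?_⟩
  obtain ⟨x, rfl⟩ := ((t.red (n + 1)).isReduction _).surjective x
  rw [t.compat, hθ₀, hθ₀, s.compat]

/-- Reduce `ψ` modulo each power, descend it there, and pass to the limit. Equalities are tested on
reductions, where uniqueness of descent applies. -/
theorem existsUnique_of_completion (hT : IsCompletion κ d) (hS : IsCompletion ι c)
    (hsq : ∀ i, (μ'.app i).hom.comp (κ.app (α.obj i)).hom = (ι.app i).hom.comp (μ.app i).hom)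
    (hdc : ∀ i, (d (α.obj i)).map (μ.app i).hom = c i) (h : IsOfFiniteDescent α μ)
    {M M' : DiagMod T'} {N N' : DiagMod S'} (hM : finiteCocartesian T' M)
    (hM' : finiteCocartesian T' M') (hN' : finiteCocartesian S' N')
    (θ : CocartesianOver α μ' M N) (θ' : CocartesianOver α μ' M' N') (ψ : N ⟶ N') :
    ∃! φ : M ⟶ M', ∀ i x, θ'.app i (Hom.app φ (α.obj i) x) = Hom.app ψ i (θ.app i x) := by
  obtain ⟨X, p, ⟨t⟩⟩ := ReductionTower.exists_tower M hT
  obtain ⟨X', p', ⟨t'⟩⟩ := ReductionTower.exists_tower M' hT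
  obtain ⟨Y, r, ⟨s⟩⟩ := ReductionTower.exists_tower N hS
  obtain ⟨Y', r', ⟨s'⟩⟩ := ReductionTower.exists_tower N' hS
  have hX := t.finiteCocartesian hT hM
  have hX' := t'.finiteCocartesian hT hM'
  obtain ⟨θ₀, hθ₀, hθp⟩ := t.exists_cocartesianOver s hT hS hsq hdc θ
  obtain ⟨θ₀', hθ₀', hθp'⟩ := t'.exists_cocartesianOver s' hT hS hsq hdc θ'
  choose ψ₀ hψ₀ using fun n => (s.red n).exists_map (s'.red n) (fun _ => le_rfl) ψ
  have hψr : ∀ n i x, Hom.app (r' n) i (Hom.app (ψ₀ (n + 1)) i x) =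
      Hom.app (ψ₀ n) i (Hom.app (r n) i x) := by
    intro n i x
    obtain ⟨x, rfl⟩ := ((s.red (n + 1)).isReduction _).surjective x
    rw [s.compat, hψ₀, hψ₀, s'.compat]
  choose φ₀ hφ₀ hφ₀' using fun n => h.existsUnique (hX n) (hX' n) (θ₀ n) (θ₀' n) (ψ₀ n)
  obtain ⟨φ, hφ⟩ := t.exists_hom t' hT hM'.1 φ₀ fun n => by
    -- Both composites descend the same map `r n ≫ ψ₀ n` from level `n + 1` to level `n`.
    refine (h.existsUnique (hX (n + 1)) (hX' n) (θ₀ (n + 1)) (θ₀' n) (r n ≫ ψ₀ n)).unique ?_ ?_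
    · intro i x
      simp only [comp_app]
      rw [hθp', hφ₀, hψr]
    · intro i x
      simp only [comp_app]
      rw [hφ₀, hθp]
  refine ⟨φ, fun i x => ?_, fun φ' hφ' => hom_app_ext fun j x => ?_⟩
  · refine (s'.isReductionTower i).ext (hS.isNoetherianCompletion i) (hN'.1 i) fun n => ?_
    simp only [← hθ₀', ← hψ₀, hφ, ← hθ₀, hφ₀]
  · refine (t'.isReductionTower j).ext (hT.isNoetherianCompletion j) (hM'.1 j) fun n => ?_
    -- The reduction of any competing `φ'` descends `ψ₀ n`, hence equals `φ₀ n`.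
    obtain ⟨φ₁, hφ₁⟩ := (t.red n).exists_map (t'.red n) (fun _ => le_rfl) φ'
    have : φ₁ = φ₀ n := hφ₀' n φ₁ fun i x => by
      obtain ⟨x, rfl⟩ := ((t.red n).isReduction _).surjective x
      rw [hφ₁, hθ₀', hφ', hθ₀, hψ₀]
    simp only [hφ, ← this, hφ₁]

/-- Each reduction of `N` descends to some `X n`. Once these are shown to form a tower, its limit is
the required module, and the maps `X n → Y n` lift to a map into `N` that is coCartesian because its
reductions are. -/
theorem exists_cocartesianOver_of_completion (hT : IsCompletion κ d) (hS : IsCompletion ι c)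
    (hsq : ∀ i, (μ'.app i).hom.comp (κ.app (α.obj i)).hom = (ι.app i).hom.comp (μ.app i).hom)
    (hdc : ∀ i, (d (α.obj i)).map (μ.app i).hom = c i) (h : IsOfFiniteDescent α μ)
    {N : DiagMod S'} (hN : finiteCocartesian S' N) :
    ∃ M, finiteCocartesian T' M ∧ Nonempty (CocartesianOver α μ' M N) := by
  obtain ⟨Y, r, ⟨s⟩⟩ := ReductionTower.exists_tower N hS
  have hY := s.finiteCocartesian hS hN
  choose X hX θ using fun n => h.exists_cocartesianOver (hY n)
  replace θ := fun n => (θ n).some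
  have hdpow : ∀ n {i j : J} (ρ : i ⟶ j), (d i ^ n).map (T.map ρ).hom = d j ^ n :=
    fun n i j ρ => by rw [Ideal.map_pow, hT.map_eq]
  have htrans : ∀ n, ∃ p : X (n + 1) ⟶ X n,
      (∀ i x, (θ n).app i (Hom.app p (α.obj i) x) = Hom.app (r n) i ((θ (n + 1)).app i x)) ∧
      (∀ j, Function.Surjective (Hom.app p j)) ∧
      (∀ j x, Hom.app p j x = 0 → x ∈ (d j ^ n • ⊤ : Submodule (T.obj j) ((X (n + 1)).obj j))) ∧
      ∀ j, ∀ a ∈ d j ^ n, ∀ x : (X n).obj j, a • x = 0 := by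
    intro n
    -- The quotient `Q` of `X (n + 1)` by `d ^ n` pulls back to the quotient of `Y (n + 1)` by `c ^
    -- n`, which is `Y n`. So `Q` and `X n` descend the same module and are isomorphic; the
    -- transition map is the projection to `Q` followed by this isomorphism. In particular `d ^ n`
    -- kills `X n`.
    obtain ⟨Q, ⟨rQ⟩⟩ := Reduction.exists_of_ideal (𝟙 T) (fun j => d j ^ n) (X (n + 1))
      fun ρ a ha => hdpow n ρ ▸ Ideal.mem_map_of_mem _ ha
    have hQ : finiteCocartesian T Q := rQ.finiteCocartesian
      (fun ρ a ha => hdpow n ρ ▸ Ideal.mem_map_of_mem _ ha) (fun j a => ⟨a, by simp⟩)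
      (fun ρ => (hdpow n ρ).ge) (hX (n + 1))
    let rY : Reduction (𝟙 S) (fun i => c i ^ n) (Y (n + 1)) (Y n) :=
      ⟨fun i => (Hom.app (r n) i).toAddMonoidHom, fun ρ x => Hom.naturality (r n) ρ x,
        fun i => s.isReduction_transition hS n i⟩
    have hdcn : ∀ i, (d (α.obj i) ^ n).map (μ.app i).hom = c i ^ n := fun i => by
      rw [Ideal.map_pow, hdc]
    obtain ⟨θQ, hθQ⟩ := rQ.exists_cocartesianOver rY (μ := μ) (fun i => rfl)
      (fun i a ha => hdcn i ▸ Ideal.mem_map_of_mem _ ha) (fun j a => ⟨a, by simp⟩)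
      (fun j a => ⟨a, by simp⟩) (fun i => (hdcn i).ge) (θ (n + 1))
    obtain ⟨e, he⟩ := h.exists_iso hQ (hX n) θQ (θ n)
    obtain ⟨π, hπ⟩ := rQ.exists_hom
    have hbij := bijective_app_of_iso e
    have hp : ∀ j x, Hom.app (π ≫ e.hom) j x = Hom.app e.hom j (rQ.q j x) := fun j x => by
      rw [comp_app, hπ]
    refine ⟨π ≫ e.hom, fun i x => ?_, fun j y => ?_, fun j x hx => ?_, fun j a ha y => ?_⟩
    · rw [hp, he, hθQ]
      rfl
    · obtain ⟨y, rfl⟩ := (hbij j).2 y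
      obtain ⟨x, rfl⟩ := (rQ.isReduction j).surjective y
      exact ⟨x, hp j x⟩
    · refine ((rQ.isReduction j).eq_zero_iff x).1 ((hbij j).1 ?_)
      rw [← hp, hx, map_zero]
    · obtain ⟨y, rfl⟩ := (hbij j).2 y
      obtain ⟨x, rfl⟩ := (rQ.isReduction j).surjective y
      rw [← map_smul, ← (rQ.isReduction j).map_smul]
      exact (congrArg _ ((rQ.isReduction j).smul_eq_zero ha x)).trans (map_zero _)
  choose p hθp hsurj hker hkill using htrans
  obtain ⟨M, hM, ⟨t⟩⟩ := ReductionTower.exists_limit X p hT hX hkill hsurj hker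
  choose ψ hψ using fun i => (t.isReductionTower (α.obj i)).exists_lift (s.isReductionTower i)
    (hT.isNoetherianCompletion _) (hS.isNoetherianCompletion i) (hsq i) (hdc i) (hN.1 i)
    (fun n => (θ n).app i) (fun n x => (hθp n i x).symm)
  refine ⟨M, hM, ⟨⟨ψ, fun {i j} ρ x => ?_, fun i => ?_⟩⟩⟩
  · refine (s.isReductionTower j).ext (hS.isNoetherianCompletion j) (hN.1 j) fun n => ?_
    rw [hψ, (s.red n).naturality, hψ, (t.red n).naturality, (θ n).naturality]
  · exact (hS.isNoetherianCompletion i).isCocartesianMap (hsq i) (hdc i) (hM.1 _) (hN.1 i)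
      (t.isReductionTower (α.obj i)).isReduction (s.isReductionTower i).isReduction
      (fun n x => (hψ i n x).symm) fun n => (θ n).isCocartesianMap i

/-- Descent for finite modules passes to completions. -/
theorem _root_.IsOfFiniteDescent.of_isCompletion (hT : IsCompletion κ d) (hS : IsCompletion ι c)
    (hsq : ∀ i, (μ'.app i).hom.comp (κ.app (α.obj i)).hom = (ι.app i).hom.comp (μ.app i).hom)
    (hdc : ∀ i, (d (α.obj i)).map (μ.app i).hom = c i) (h : IsOfFiniteDescent α μ) :
    IsOfFiniteDescent α μ' :=
  isOfFiniteDescent_of_cocartesianOver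
    (fun hM hM' _ hN' => existsUnique_of_completion hT hS hsq hdc h hM hM' hN')
    (exists_cocartesianOver_of_completion hT hS hsq hdc h)

end DiagMod

end CompletedDescent

/-! ### The adic completion of diagrams of noetherian algebras -/

section AdicCompletionDescent

/-- For a finitely generated ideal, the kernel of evaluation at level `n` is the `n`-th power of the
extended ideal; this can fail without finite generation. -/
theorem AdicCompletion.mem_map_algebraMap_pow_iff {A : Type v} [CommRing A] {I : Ideal A}
    (hI : I.FG) (n : ℕ) (x : AdicCompletion I A) :
    x ∈ I.map (algebraMap A (AdicCompletion I A)) ^ n ↔ AdicCompletion.eval I A n x = 0 := by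
  rw [← LinearMap.mem_ker, ← AdicCompletion.pow_smul_top_eq_ker_eval hI, Ideal.smul_top_eq_map,
    Ideal.map_pow]
  rfl

/-- Density and `mem_pow` both express that `A / I ^ n` is the quotient of the completion by the
`n`-th power of the extended ideal. -/
theorem isNoetherianCompletion_adicCompletion {A : Type v} [CommRing A] (I : Ideal A)
    (hI : I.FG) (h : IsNoetherianRing (AdicCompletion I A)) :
    IsNoetherianCompletion (algebraMap A (AdicCompletion I A)) I where
  isNoetherianRing := h
  isAdicComplete := (IsAdicComplete.map_algebraMap_iff _ _).2 (AdicCompletion.isAdicComplete hI)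
  dense n x := by
    obtain ⟨a, ha⟩ := Submodule.mkQ_surjective _ (AdicCompletion.eval I A n x)
    refine ⟨a, (AdicCompletion.mem_map_algebraMap_pow_iff hI n _).2 ?_⟩
    rw [map_sub, sub_eq_zero, ← ha]
    rfl
  mem_pow n a ha := by
    have := (AdicCompletion.mem_map_algebraMap_pow_iff hI n _).1 ha
    have h2 : a ∈ (I ^ n • ⊤ : Submodule A A) := (Submodule.Quotient.mk_eq_zero _).1 this
    simpa using h2

variable {R : Type u} [CommRing R] (𝔞 : Ideal R)

theorem extIdeal_map {A B : Type v} [CommRing A] [CommRing B] [Algebra R A] [Algebra R B]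
    (f : A →ₐ[R] B) : (extIdeal 𝔞 A).map (f : A →+* B) = extIdeal 𝔞 B := by
  rw [extIdeal, Ideal.map_map, AlgHom.comp_algebraMap]

theorem completionMap_algebraMap {A B : Type v} [CommRing A] [CommRing B] [Algebra R A]
    [Algebra R B] (f : A →ₐ[R] B) (a : A) :
    completionMap 𝔞 f (algebraMap A (AdicCompletion (extIdeal 𝔞 A) A) a) =
      algebraMap B (AdicCompletion (extIdeal 𝔞 B) B) (f a) := by
  refine AdicCompletion.ext_evalₐ fun n => ?_
  rw [evalₐ_completionMap, AdicCompletion.algebraMap_apply, AdicCompletion.algebraMap_apply,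
    AdicCompletion.evalₐ_of, AdicCompletion.evalₐ_of]
  rfl

variable {I : Type u₁} [Category.{v₁} I]

/-- The natural transformation from a diagram of algebras to its completion. -/
noncomputable def toCompletion (F : I ⥤ CommAlgCat.{v} R) :
    F ⋙ forget₂ (CommAlgCat.{v} R) CommRingCat.{v} ⟶
      (F ⋙ completionFunctor 𝔞) ⋙ forget₂ (CommAlgCat.{v} R) CommRingCat.{v} where
  app i := CommRingCat.ofHom
    (algebraMap (F.obj i) (AdicCompletion (extIdeal 𝔞 (F.obj i)) (F.obj i)))
  naturality _ _ ρ := CommRingCat.hom_ext <| RingHom.ext fun a =>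
    (completionMap_algebraMap 𝔞 (F.map ρ).hom a).symm

theorem isCompletion_toCompletion (F : I ⥤ CommAlgCat.{v} R)
    (hF : ∀ i, IsNoetherianRing (F.obj i))
    (hCF : ∀ i, IsNoetherianRing ((completionFunctor 𝔞).obj (F.obj i))) :
    DiagMod.IsCompletion (toCompletion 𝔞 F) fun i => extIdeal 𝔞 (F.obj i) where
  isNoetherianCompletion i := isNoetherianCompletion_adicCompletion _
    ((hF i).noetherian _) (hCF i)
  map_eq ρ := extIdeal_map 𝔞 (F.map ρ).hom

end AdicCompletionDescent

/-- Completion preserves descent for finitely generated modules. -/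
theorem mainTheorem5 {R : Type u} [CommRing R] (𝔞 : Ideal R)
    {I : Type u₁} [Category.{v₁} I] {J : Type u₂} [Category.{v₂} J]
    (F : I ⥤ CommAlgCat.{v} R) (G : J ⥤ CommAlgCat.{v} R)
    (α : I ⥤ J) (μ : α ⋙ G ⟶ F)
    (hF : ∀ i, IsNoetherianRing (F.obj i)) (hG : ∀ j, IsNoetherianRing (G.obj j))
    (hCF : ∀ i, IsHausdorff 𝔞 ((completionFunctor 𝔞).obj (F.obj i)) ∧
      IsNoetherianRing ((completionFunctor 𝔞).obj (F.obj i)))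
    (hCG : ∀ j, IsHausdorff 𝔞 ((completionFunctor 𝔞).obj (G.obj j)) ∧
      IsNoetherianRing ((completionFunctor 𝔞).obj (G.obj j)))
    (h : IsOfFiniteDescentAlg α μ) :
    IsOfFiniteDescentAlg (F := F ⋙ completionFunctor 𝔞) (G := G ⋙ completionFunctor 𝔞) α
      (Functor.whiskerRight μ (completionFunctor 𝔞)) := by
  have hT := isCompletion_toCompletion 𝔞 G hG fun j => (hCG j).2
  have hS := isCompletion_toCompletion 𝔞 F hF fun i => (hCF i).2
  let μ₁ : α ⋙ G ⋙ forget₂ (CommAlgCat.{v} R) CommRingCat.{v} ⟶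
      F ⋙ forget₂ (CommAlgCat.{v} R) CommRingCat.{v} :=
    Functor.whiskerRight μ (forget₂ (CommAlgCat.{v} R) CommRingCat.{v})
  let μ₂ : α ⋙ (G ⋙ completionFunctor 𝔞) ⋙ forget₂ (CommAlgCat.{v} R) CommRingCat.{v} ⟶
      (F ⋙ completionFunctor 𝔞) ⋙ forget₂ (CommAlgCat.{v} R) CommRingCat.{v} :=
    Functor.whiskerRight (Functor.whiskerRight μ (completionFunctor 𝔞))
    (forget₂ (CommAlgCat.{v} R) CommRingCat.{v})
  have hsq : ∀ i, (μ₂.app i).hom.comp ((toCompletion 𝔞 G).app (α.obj i)).hom =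
      ((toCompletion 𝔞 F).app i).hom.comp (μ₁.app i).hom :=
    fun i => RingHom.ext fun a => completionMap_algebraMap 𝔞 (μ.app i).hom a
  have hmap : ∀ i, (extIdeal 𝔞 (G.obj (α.obj i))).map (μ₁.app i).hom = extIdeal 𝔞 (F.obj i) :=
    fun i => extIdeal_map 𝔞 (μ.app i).hom
  have h₁ : IsOfFiniteDescent α μ₁ := h
  have h₂ : IsOfFiniteDescent α μ₂ := IsOfFiniteDescent.of_isCompletion hT hS hsq hmap h₁
  exact h₂
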